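/- **Model.** Let $\theta=(K,A,\beta,\Sigma_Z,\Sigma_W,\sigma^2)$ with $A\in\mathbb R^{p\times K}$ and $\beta\in\mathbb R^K$. A pair $(X,Y)\in\mathbb R^p\times\mathbb R$ follows the sub-Gaussian factor regression model sG-FRM$(\theta)$ with constants $\gamma_\varepsilon,\gamma_z,\gamma_w>0$ if $$X=AZ+W,\qquad Y=Z^\top\beta+\varepsilon,$$ where $Z\in\mathbb R^K$, $W\in\mathbb R^p$, $\varepsilon\in\mathbb R$ are mutually independent and mean zero with $\mathbb E[ZZ^\top]=\Sigma_Z$, $\mathbb E[WW^\top]=\Sigma_W$, $\mathbb E[\varepsilon^2]=\sigma^2$; both $A$ and $\Sigma_Z$ have rank $K$; $\varepsilon$ is $\sigma\gamma_\varepsilon$ sub-Gaussian; $Z=\Sigma_Z^{1/2}\widetilde Z$ and $W=\Sigma_W^{1/2}\widetilde W$, where $\widetilde Z$ is a $\gamma_z$ sub-Gaussian and $\widetilde W$ a $\gamma_w$ sub-Gaussian mean-zero random vector, with $\mathbb E[\widetilde Z\widetilde Z^\top]=I_K$ and $\mathbb E[\widetilde W\widetilde W^\top]=I_p$. (A mean-zero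 random variable $x$ is $\gamma$ sub-Gaussian if $\mathbb E[e^{tx}]\le e^{t^2\gamma^2/2}$ for all $t\in\mathbb R$; a random vector is $\gamma$ sub-Gaussian if all its one-dimensional projections along unit vectors are.) **Predictor.** Let $\mathbf X\in\mathbb R^{n\times p}$ and $\mathbf Y\in\mathbb R^n$ collect $n\ge1$ independent copies of $(X,Y)$. Let $\sigma_1(\mathbf X)\ge\sigma_2(\mathbf X)\ge\cdots$ be the singular values of $\mathbf X$, and put $\widehat\lambda_j=\sigma_j^2(\mathbf X)/n$ for $j\ge1$, with $\widehat\lambda_0=\infty$ and $\widehat\lambda_j=0$ for $j>\mathrm{rank}(\mathbf X)$. For $0\le k\le\mathrm{rank}(\mathbf X)$ let $\mathbf U_k\in\mathbb R^{p\times k}$ be the matrix of the first $k$ right singular vectors of $\mathbf X$ (chosen as a measurable function of $\mathbf X$), let $$\widehat\alpha_k=\mathbf U_k\bigl[\mathbf U_k^\top\mathbf X^\top\mathbf X\mathbf U_k\bigr]^+\mathbf U_k^\top\mathbf X^\top\mathbf Y,$$ with $M^+$ the Moore–Penrose inverse, and let $\mathcal R(\mathbf U_k)=\mathbb E_{(X_*,Y_*)}[(Y_*-X_*^\top\widehat\alpha_k)^2]$,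 where the expectation is only over a new copy $(X_*,Y_*)$ of $(X,Y)$, independent of the data. For a constant $c_W>0$ let $\delta_W=c_W\bigl(\|\Sigma_W\|_{\rm op}+\mathrm{tr}(\Sigma_W)/n\bigr)$ and $$\widehat B_1(k)=\Bigl[\frac{\|\Sigma_W\|_{\rm op}}{\widehat\lambda_k}k+\Bigl(1+\frac{\delta_W}{\widehat\lambda_k}\Bigr)\bigl(\min(K,k)+\log n\bigr)\Bigr]\frac{\sigma^2}{n},$$ $$\widehat B_2(k)=\Bigl(\frac{\|\Sigma_W\|_{\rm op}}{\widehat\lambda_k}\delta_W+\delta_W+\widehat\lambda_{k+1}\Bigr)\beta^\top(A^\top A)^{-1}\beta .$$ **Claim.** There are an absolute constant $c>0$ and positive constants $C=C(\gamma_z)$, $c_W=c_W(\gamma_w)$ and $D=D(\gamma_\varepsilon,\gamma_z,\gamma_w)$ such that for all $\gamma_\varepsilon,\gamma_z,\gamma_w>0$, all $n\ge1$ and $p$, every $\theta$ with $K\log n\le Cn$ such that $(X,Y)$ follows sG-FRM$(\theta)$ with these constants, and every (possibly random) integer $k$ with $0\le k\le\mathrm{rank}(\mathbf X)$ almost surely,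 $$\mathbb P\Bigl\{\mathcal R(\mathbf U_k)-\sigma^2\le D\bigl(\widehat B_1(k)+\widehat B_2(k)\bigr)\Bigr\}\ge1-\frac cn .$$ -/

import Mathlib

open MeasureTheory ProbabilityTheory Matrix
open scoped NNReal ENNReal

namespace FactorPCR

noncomputable section

/-! ### Matrix notions -/

/-- The `ℓ²` operator norm of a square matrix. -/
def opNorm {p : ℕ} (M : Matrix (Fin p) (Fin p) ℝ) : ℝ :=
  ‖Matrix.toEuclideanCLM (n := Fin p) (𝕜 := ℝ) M‖

open scoped MatrixOrder in
/-- The positive semi-definite square root of a positive semi-definite matrix. -/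
def matSqrt {d : ℕ} (M : Matrix (Fin d) (Fin d) ℝ) : Matrix (Fin d) (Fin d) ℝ :=
  CFC.sqrt M

/-- The `k`-th largest singular value `σ_k(M)`, `k = 1, 2, …`; it is `0` for `k > rank M`.
(The value at `k = 0` is never used.) -/
def singularValue {n p : ℕ} (M : Matrix (Fin n) (Fin p) ℝ) (k : ℕ) : ℝ :=
  (Matrix.toEuclideanLin M).singularValues (k - 1)

/-- The four Penrose conditions: `N` is the Moore-Penrose inverse of `M`. -/
structure IsMoorePenrose {m n : Type*} [Fintype m] [Fintype n]
    (M : Matrix m n ℝ) (N : Matrix n m ℝ) : Prop where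
  mul_mul_self : M * N * M = M
  mul_mul_inv : N * M * N = N
  symm_left : (M * N)ᵀ = M * N
  symm_right : (N * M)ᵀ = N * M

theorem exists_isMoorePenrose {m n : Type*} [Fintype m] [Fintype n]
    (M : Matrix m n ℝ) : ∃ N : Matrix n m ℝ, IsMoorePenrose M N := by
  classical
  have hG : (Mᵀ * M).IsHermitian := by
    simpa [Matrix.conjTranspose_eq_transpose_of_trivial] using
      Matrix.isHermitian_conjTranspose_mul_self M
  obtain ⟨H, hHt, hGHG, hHGH, hcomm⟩ : ∃ H : Matrix n n ℝ, Hᵀ = H ∧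
      (Mᵀ * M) * H * (Mᵀ * M) = Mᵀ * M ∧ H * (Mᵀ * M) * H = H ∧
      H * (Mᵀ * M) = (Mᵀ * M) * H := by
    set G := Mᵀ * M
    have hsa : IsSelfAdjoint G := hG
    have hc : ∀ f : ℝ → ℝ, ContinuousOn f (spectrum ℝ G) := fun f =>
      (Matrix.finite_real_spectrum (A := G)).continuousOn f
    have hid : cfc (fun x : ℝ => x) G = G := cfc_id' ℝ G
    refine ⟨cfc (fun x : ℝ => x⁻¹) G, ?_, ?_, ?_, ?_⟩
    · have : IsSelfAdjoint (cfc (fun x : ℝ => x⁻¹) G) := cfc_predicate _ _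
      simpa [Matrix.star_eq_conjTranspose, Matrix.conjTranspose_eq_transpose_of_trivial]
        using this.star_eq
    · nth_rewrite 1 [← hid]
      nth_rewrite 3 [← hid]
      rw [← cfc_mul _ _ G (hc _) (hc _), ← cfc_mul _ _ G (hc _) (hc _)]
      simp only [mul_inv_mul_cancel]
      exact hid
    · nth_rewrite 2 [← hid]
      rw [← cfc_mul _ _ G (hc _) (hc _), ← cfc_mul _ _ G (hc _) (hc _)]
      congr 1
      funext x
      by_cases hx : x = 0 <;> simp [hx]
    · have h := cfc_commute_cfc (fun x : ℝ => x⁻¹) (fun x : ℝ => x) G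
      rwa [hid] at h
  have hEt : (H * (Mᵀ * M))ᵀ = H * (Mᵀ * M) := by
    rw [Matrix.transpose_mul, hHt, Matrix.transpose_mul, Matrix.transpose_transpose, hcomm]
  refine ⟨H * Mᵀ, ?_, ?_, ?_, ?_⟩
  · have key : (M - M * (H * (Mᵀ * M)))ᵀ * (M - M * (H * (Mᵀ * M))) = 0 := by
      have h1 : (Mᵀ * M) * (H * (Mᵀ * M)) = Mᵀ * M := by rw [← Matrix.mul_assoc, hGHG]
      have h2 : Mᵀ * (M - M * (H * (Mᵀ * M))) = 0 := by
        rw [Matrix.mul_sub, ← Matrix.mul_assoc, h1, sub_self]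
      rw [Matrix.transpose_sub, Matrix.transpose_mul, Matrix.sub_mul, h2, Matrix.mul_assoc, h2]
      simp
    have h0 : M - M * (H * (Mᵀ * M)) = 0 := by
      rw [← Matrix.conjTranspose_eq_transpose_of_trivial] at key
      exact Matrix.conjTranspose_mul_self_eq_zero.mp key
    simp only [Matrix.mul_assoc]
    exact (sub_eq_zero.mp h0).symm
  · calc H * Mᵀ * M * (H * Mᵀ) = (H * (Mᵀ * M) * H) * Mᵀ := by simp only [Matrix.mul_assoc]
      _ = H * Mᵀ := by rw [hHGH]
  · simp only [Matrix.transpose_mul, Matrix.transpose_transpose, hHt, Matrix.mul_assoc]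
  · rw [Matrix.mul_assoc]; exact hEt

/-- The Moore-Penrose inverse `M⁺`. -/
def pinv {m n : Type*} [Fintype m] [Fintype n] (M : Matrix m n ℝ) : Matrix n m ℝ :=
  Classical.choose (exists_isMoorePenrose M)

/-! ### The sub-Gaussian factor regression model -/

/-- The parameter `θ = (K, A, β, Σ_Z, Σ_W, σ²)`; here `sigma` is `σ = √σ² ≥ 0`. -/
structure Params (p K : ℕ) where
  A : Matrix (Fin p) (Fin K) ℝ
  beta : Fin K → ℝ
  SigmaZ : Matrix (Fin K) (Fin K) ℝ
  SigmaW : Matrix (Fin p) (Fin p) ℝ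
  sigma : ℝ≥0

/-- The random vector `V` is square integrable with `E[V] = 0` and `E[V Vᵀ] = S`. -/
structure CenteredWithSecondMoment {Ω : Type*} [MeasurableSpace Ω] (P : Measure Ω) {d : ℕ}
    (V : Ω → Fin d → ℝ) (S : Matrix (Fin d) (Fin d) ℝ) : Prop where
  measurable : Measurable V
  memLp : ∀ i, MemLp (fun ω => V ω i) 2 P
  mean_zero : ∀ i, ∫ ω, V ω i ∂P = 0
  second_moment : ∀ i j, ∫ ω, V ω i * V ω j ∂P = S i j

/-- A random vector is `γ` sub-Gaussian if `E exp(t⟨V, v⟩) ≤ exp(t²γ²/2)` for all real `t` and all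
Euclidean unit vectors `v`. -/
def SubGaussianVector {Ω : Type*} [MeasurableSpace Ω] (P : Measure Ω) {d : ℕ}
    (V : Ω → Fin d → ℝ) (γ : ℝ≥0) : Prop :=
  ∀ v : Fin d → ℝ, v ⬝ᵥ v = 1 → HasSubgaussianMGF (fun ω => V ω ⬝ᵥ v) (γ ^ 2) P

/-- `(X, Y)` follows the factor regression model with parameter `θ` and latent variables
`Z, W, ε`. -/
structure IsFRM {Ω : Type*} [MeasurableSpace Ω] (P : Measure Ω) {p K : ℕ} (θ : Params p K)
    (X : Ω → Fin p → ℝ) (Y : Ω → ℝ)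
    (Z : Ω → Fin K → ℝ) (W : Ω → Fin p → ℝ) (ε : Ω → ℝ) : Prop where
  eq_X : ∀ᵐ ω ∂P, X ω = θ.A *ᵥ Z ω + W ω
  eq_Y : ∀ᵐ ω ∂P, Y ω = Z ω ⬝ᵥ θ.beta + ε ω
  /-- with the next field: `Z`, `W`, `ε` are mutually independent -/
  indep_ZW : IndepFun Z W P
  indep_ZWε : IndepFun (fun ω => (Z ω, W ω)) ε P
  moments_Z : CenteredWithSecondMoment P Z θ.SigmaZ
  moments_W : CenteredWithSecondMoment P W θ.SigmaW
  measurable_ε : Measurable ε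
  memLp_ε : MemLp ε 2 P
  mean_ε : ∫ ω, ε ω ∂P = 0
  second_moment_ε : ∫ ω, ε ω ^ 2 ∂P = (θ.sigma : ℝ) ^ 2
  rank_A : θ.A.rank = K
  rank_SigmaZ : θ.SigmaZ.rank = K

/-- `(X, Y) ∼ sG-FRM(θ)` with sub-Gaussian constants `γε`, `γz`, `γw`. -/
def IsSubGaussianFRM {Ω : Type*} [MeasurableSpace Ω] (P : Measure Ω) {p K : ℕ}
    (θ : Params p K) (γε γz γw : ℝ≥0) (X : Ω → Fin p → ℝ) (Y : Ω → ℝ) : Prop :=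
  ∃ (Z : Ω → Fin K → ℝ) (W : Ω → Fin p → ℝ) (ε : Ω → ℝ),
    IsFRM P θ X Y Z W ε ∧
    HasSubgaussianMGF ε ((θ.sigma * γε) ^ 2) P ∧
    (∃ Z' : Ω → Fin K → ℝ, CenteredWithSecondMoment P Z' 1 ∧ SubGaussianVector P Z' γz ∧
      ∀ᵐ ω ∂P, Z ω = matSqrt θ.SigmaZ *ᵥ Z' ω) ∧
    (∃ W' : Ω → Fin p → ℝ, CenteredWithSecondMoment P W' 1 ∧ SubGaussianVector P W' γw ∧
      ∀ᵐ ω ∂P, W ω = matSqrt θ.SigmaW *ᵥ W' ω)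

/-- `(X i, Y i)`, `i < n`, are `n` independent copies of `(X₀, Y₀)`. -/
structure IsIIDSample {Ω₀ Ω : Type*} [MeasurableSpace Ω₀] [MeasurableSpace Ω]
    (P₀ : Measure Ω₀) (P : Measure Ω) {n p : ℕ} (X₀ : Ω₀ → Fin p → ℝ) (Y₀ : Ω₀ → ℝ)
    (X : Ω → Matrix (Fin n) (Fin p) ℝ) (Y : Ω → Fin n → ℝ) : Prop where
  measurable_X : ∀ i j, Measurable fun ω => X ω i j
  measurable_Y : ∀ i, Measurable fun ω => Y ω i
  indep : iIndepFun (fun i ω => ((X ω i, Y ω i) : (Fin p → ℝ) × ℝ)) P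
  identDistrib : ∀ i,
    IdentDistrib (fun ω => ((X ω i, Y ω i) : (Fin p → ℝ) × ℝ)) (fun ω => (X₀ ω, Y₀ ω)) P P₀

/-! ### Principal component regression -/

/-- The columns of the orthogonal matrix `U` are right singular vectors of `M`, ordered along the
non-increasing singular values of `M` (completed by a basis of the kernel). -/
structure IsRightSingularBasis {n p : ℕ} (M : Matrix (Fin n) (Fin p) ℝ)
    (U : Matrix (Fin p) (Fin p) ℝ) : Prop where
  orthogonal : Uᵀ * U = 1
  eigen : ∀ j : Fin p, (Mᵀ * M) *ᵥ U.col j = singularValue M (j + 1) ^ 2 • U.col j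

/-- `U_k`: the matrix of the first `k` columns of `U` (for `k ≤ p`). -/
def firstCols {p : ℕ} (U : Matrix (Fin p) (Fin p) ℝ) (k : ℕ) :
    Matrix (Fin p) {j : Fin p // (j : ℕ) < k} ℝ :=
  U.submatrix id Subtype.val

/-- The coefficient vector `B (Bᵀ 𝐗ᵀ 𝐗 B)⁺ Bᵀ 𝐗ᵀ 𝐘` of the linear predictor given by `B`. -/
def coef {n p : ℕ} {q : Type*} [Fintype q] (X : Matrix (Fin n) (Fin p) ℝ) (Y : Fin n → ℝ)
    (B : Matrix (Fin p) q ℝ) : Fin p → ℝ :=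
  (B * pinv (Bᵀ * Xᵀ * X * B) * Bᵀ * Xᵀ) *ᵥ Y

/-- The risk `E[(Y_* - X_*ᵀ α)²]` at a new data point `(X_*, Y_*)` distributed as `(X₀, Y₀)`. -/
def risk {Ω₀ : Type*} [MeasurableSpace Ω₀] (P₀ : Measure Ω₀) {p : ℕ}
    (X₀ : Ω₀ → Fin p → ℝ) (Y₀ : Ω₀ → ℝ) (α : Fin p → ℝ) : ℝ≥0∞ :=
  ∫⁻ ω, ENNReal.ofReal ((Y₀ ω - X₀ ω ⬝ᵥ α) ^ 2) ∂P₀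

/-- `λ̂_k = σ_k(𝐗)² / n`, with `λ̂_0 = ∞`. -/
def lambdaHat {n p : ℕ} (X : Matrix (Fin n) (Fin p) ℝ) (k : ℕ) : ℝ≥0∞ :=
  if k = 0 then ∞ else ENNReal.ofReal (singularValue X k ^ 2 / n)

/-- `‖Σ_W‖_op`. -/
def Params.noiseNorm {p K : ℕ} (θ : Params p K) : ℝ≥0∞ := ENNReal.ofReal (opNorm θ.SigmaW)

/-- `δ_W = c (‖Σ_W‖_op + tr(Σ_W) / n)`. -/
def Params.deltaW {p K : ℕ} (θ : Params p K) (c : ℝ) (n : ℕ) : ℝ≥0∞ :=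
  ENNReal.ofReal (c * (opNorm θ.SigmaW + θ.SigmaW.trace / n))

/-- `βᵀ (Aᵀ A)⁻¹ β`. -/
def Params.betaQuad {p K : ℕ} (θ : Params p K) : ℝ≥0∞ :=
  ENNReal.ofReal (θ.beta ⬝ᵥ ((θ.Aᵀ * θ.A)⁻¹ *ᵥ θ.beta))

/-- The variance term `B̂₁(k)`. -/
def B1 {n p K : ℕ} (θ : Params p K) (cW : ℝ) (X : Matrix (Fin n) (Fin p) ℝ) (k : ℕ) : ℝ≥0∞ :=
  (θ.noiseNorm / lambdaHat X k * k +
      (1 + θ.deltaW cW n / lambdaHat X k) * ((min K k : ℕ) + ENNReal.ofReal (Real.log n))) *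
    ENNReal.ofReal ((θ.sigma : ℝ) ^ 2 / n)

/-- The bias term `B̂₂(k)`. -/
def B2 {n p K : ℕ} (θ : Params p K) (cW : ℝ) (X : Matrix (Fin n) (Fin p) ℝ) (k : ℕ) : ℝ≥0∞ :=
  (θ.noiseNorm / lambdaHat X k * θ.deltaW cW n + θ.deltaW cW n + lambdaHat X (k + 1)) *
    θ.betaQuad

end

end FactorPCR

open MeasureTheory ProbabilityTheory Matrix
open scoped NNReal ENNReal

namespace FactorPCR

/-! ### Exponential moments of quadratic forms -/

/-! Put `a = A(AᵀA)⁻¹β`, so that `Aᵀa = β` and `‖a‖² = βᵀ(AᵀA)⁻¹β`. On the latent space `𝐘 = 𝐙Aᵀa +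
ε = (𝐗 - 𝐖)a + ε`, and the estimator is `α̂ = R𝐘`, where `R` is the spectral cut-off `pcInv`. For `k
≤ rank 𝐗`, `R𝐗 = Π` projects onto the first `k` right singular directions, and `𝐗R` is an orthogonal
projection too. By independence (`IsFRM.risk_eq`) the excess risk is `vᵀΣ_Z v + α̂ᵀΣ_W α̂` with `v =
β - Aᵀα̂`.

When `‖𝐙u‖² ≥ (3/64) n uᵀΣ_Z u` for all `u`, the first term is at most a multiple of `‖𝐙v‖²/n`, and
`𝐙v = 𝐗(a - Πa) - 𝐖(a - Πa) + 𝐙AᵀR𝐖a - 𝐙AᵀRε`. The first piece costs `λ̂_{k+1}`, the second `δ_W`.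
Since `𝐙AᵀR = 𝐗R - 𝐖R`, one has `‖𝐙AᵀR‖² ≤ 2 + 2δ_W/λ̂_k`. As `a` is deterministic, `‖𝐖a‖²` is of
order `n‖Σ_W‖‖a‖²` without a trace term, whence `‖Σ_W‖δ_W/λ̂_k` in the bias instead of `δ_W²/λ̂_k`.
The noise piece has rank at most `min(K, k)`. For the second term, `α̂ = Πa - R𝐖a + Rε` and `‖Rx‖² ≤
‖𝐗Rx‖²/(nλ̂_k)`; here the noise has rank at most `k`.

All upper deviations come from `LaplaceBound.measure_sq_gt_le`, a tail bound for `‖η‖²` when the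
Laplace transform of `η` is dominated by a Gaussian one. It is applied to `𝐖a`, to `𝐖ᵀu` over a net
of `u`, and to the noise conditionally on `(𝐙, 𝐖)`. The lower bound on `𝐙`
(`exists_measure_rows_lower_le`) combines a one-sided Chernoff bound with a net; this is where `K
log n ≤ Cn` enters. Noise events have probability at most `n⁻²` for each `k ≤ n`, so a union bound
covers all `k` at once and `k` may depend on the data. -/

theorem lintegral_pi_prod {ι : Type*} [Fintype ι] {α : ι → Type*} [∀ i, MeasurableSpace (α i)]
    (μ : ∀ i, Measure (α i)) [∀ i, IsProbabilityMeasure (μ i)] {f : ∀ i, α i → ℝ≥0∞}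
    (hf : ∀ i, Measurable (f i)) :
    ∫⁻ x, ∏ i, f i (x i) ∂Measure.pi μ = ∏ i, ∫⁻ x, f i x ∂μ i := by
  have h := lintegral_prod_eq_prod_lintegral_of_indepFun (μ := Measure.pi μ) Finset.univ
    (fun i x => f i (x i)) (iIndepFun_pi (X := f) fun i => (hf i).aemeasurable)
    (fun i => (hf i).comp (measurable_pi_apply i))
  rw [h]
  exact Finset.prod_congr rfl fun i _ => (measurePreserving_eval μ i).lintegral_comp (hf i)

theorem ofReal_exp_sum {ι : Type*} (s : Finset ι) (f : ι → ℝ) :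
    ENNReal.ofReal (Real.exp (∑ i ∈ s, f i)) = ∏ i ∈ s, ENNReal.ofReal (Real.exp (f i)) := by
  rw [Real.exp_sum, ENNReal.ofReal_prod_of_nonneg fun _ _ => (Real.exp_pos _).le]

theorem lintegral_exp_gaussianReal (a : ℝ) :
    ∫⁻ g, ENNReal.ofReal (Real.exp (a * g)) ∂gaussianReal 0 1 =
      ENNReal.ofReal (Real.exp (a ^ 2 / 2)) := by
  rw [← ofReal_integral_eq_lintegral_ofReal]
  · have h := mgf_gaussianReal (X := id) (p := gaussianReal 0 1) (μ := 0) (v := 1) (by simp) a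
    simp only [mgf, id] at h
    rw [h]; simp
  · exact integrable_exp_mul_gaussianReal a
  · exact ae_of_all _ fun _ => (Real.exp_pos _).le

/-- The Gaussian integral equals `(1 - 2l)^(-1/2)`, and `(1 - 2l)(1 + 4l) ≥ 1` on `0 ≤ l ≤ 1/4`. -/
theorem lintegral_exp_sq_gaussianReal_le {l : ℝ} (h0 : 0 ≤ l) (h1 : 4 * l ≤ 1) :
    ∫⁻ g, ENNReal.ofReal (Real.exp (l * g ^ 2)) ∂gaussianReal 0 1 ≤
      ENNReal.ofReal (Real.exp (2 * l)) := by
  have hb : 0 < 1 / 2 - l := by linarith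
  rw [gaussianReal_of_var_ne_zero _ one_ne_zero,
    lintegral_withDensity_eq_lintegral_mul _ (measurable_gaussianPDF _ _) (by fun_prop)]
  have : ∀ x : ℝ, (gaussianPDF 0 1 * fun g => ENNReal.ofReal (Real.exp (l * g ^ 2))) x =
      ENNReal.ofReal ((√(2 * Real.pi))⁻¹ * Real.exp (-(1 / 2 - l) * x ^ 2)) := by
    intro x
    rw [Pi.mul_apply, gaussianPDF, ← ENNReal.ofReal_mul (gaussianPDFReal_nonneg _ _ _),
      gaussianPDFReal]
    simp only [NNReal.coe_one, mul_one, sub_zero]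
    rw [mul_assoc, ← Real.exp_add]
    congr 3; ring
  simp_rw [this]
  rw [← ofReal_integral_eq_lintegral_ofReal]
  · rw [integral_const_mul, integral_gaussian]
    apply ENNReal.ofReal_le_ofReal
    rw [← Real.sqrt_inv, ← Real.sqrt_mul (by positivity)]
    apply Real.sqrt_le_iff.2 ⟨(Real.exp_pos _).le, ?_⟩
    have e : (2 * Real.pi)⁻¹ * (Real.pi / (1 / 2 - l)) = (1 - 2 * l)⁻¹ := by
      have := Real.pi_pos.ne'
      have : (1 - 2 * l) ≠ 0 := by linarith
      field_simp
    rw [e, ← Real.exp_nat_mul, inv_le_iff_one_le_mul₀ (by linarith)]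
    have := Real.add_one_le_exp (((2 : ℕ) : ℝ) * (2 * l))
    push_cast at this ⊢
    nlinarith
  · exact (integrable_exp_neg_mul_sq hb).const_mul _
  · exact ae_of_all _ fun _ => by positivity

/-- The Laplace transform of `η` is dominated by that of a centered Gaussian vector with
covariance `S`. -/
def LaplaceBound {Ω : Type*} [MeasurableSpace Ω] (μ : Measure Ω) {d : ℕ}
    (η : Ω → Fin d → ℝ) (S : Matrix (Fin d) (Fin d) ℝ) : Prop :=
  ∀ v, ∫⁻ ω, ENNReal.ofReal (Real.exp (η ω ⬝ᵥ v)) ∂μ ≤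
    ENNReal.ofReal (Real.exp ((v ⬝ᵥ S *ᵥ v) / 2))

theorem exists_orthogonal_diagonal {d : ℕ} {S : Matrix (Fin d) (Fin d) ℝ} (hS : S.PosSemidef) :
    ∃ (Q : Matrix (Fin d) (Fin d) ℝ) (l : Fin d → ℝ), Q * Qᵀ = 1 ∧ Qᵀ * Q = 1 ∧
      S = Q * diagonal l * Qᵀ ∧ (∀ j, 0 ≤ l j) ∧ S.trace = ∑ j, l j ∧
      S.rank = Fintype.card {i // l i ≠ 0} := by
  have h1 := Unitary.mul_star_self_of_mem hS.1.eigenvectorUnitary.2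
  have h2 := Unitary.star_mul_self_of_mem hS.1.eigenvectorUnitary.2
  rw [star_eq_conjTranspose, conjTranspose_eq_transpose_of_trivial] at h1 h2
  refine ⟨hS.1.eigenvectorUnitary, hS.1.eigenvalues, h1, h2, ?_, hS.eigenvalues_nonneg, ?_, ?_⟩
  · have := hS.1.spectral_theorem
    rw [Unitary.conjStarAlgAut_apply, star_eq_conjTranspose,
      conjTranspose_eq_transpose_of_trivial] at this
    simpa using this
  · simpa using hS.1.trace_eq_sum_eigenvalues
  · exact hS.1.rank_eq_card_non_zero_eigs

theorem dotProduct_mulVec_orthogonal_diagonal {d : ℕ} {Q S : Matrix (Fin d) (Fin d) ℝ}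
    {l : Fin d → ℝ} (h2 : Qᵀ * Q = 1) (hS : S = Q * diagonal l * Qᵀ) (w : Fin d → ℝ) :
    (Q *ᵥ w) ⬝ᵥ S *ᵥ (Q *ᵥ w) = ∑ j, l j * w j ^ 2 := by
  have : S *ᵥ (Q *ᵥ w) = Q *ᵥ (diagonal l *ᵥ w) := by
    rw [hS, mulVec_mulVec, Matrix.mul_assoc, h2, Matrix.mul_one, ← mulVec_mulVec]
  rw [this, dotProduct_mulVec, vecMul_mulVec, h2, vecMul_one]
  simp only [dotProduct, mulVec_diagonal]
  exact Finset.sum_congr rfl fun j _ => by ring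

theorem dotProduct_orthogonal_mulVec {d : ℕ} {Q : Matrix (Fin d) (Fin d) ℝ}
    (h2 : Qᵀ * Q = 1) (w : Fin d → ℝ) : (Q *ᵥ w) ⬝ᵥ (Q *ᵥ w) = w ⬝ᵥ w := by
  rw [dotProduct_mulVec, vecMul_mulVec, h2, vecMul_one]

/-- Gaussian decoupling: `exp(s‖y‖²) = E_g exp(√(2s)⟨y, Qg⟩)` for a standard Gaussian `g` and
orthogonal `Q`. After exchanging the integrals the hypothesis bounds the inner one by a quadratic
exponential in `g`, which factorises when `Q` diagonalises `S`. -/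
theorem LaplaceBound.lintegral_exp_sq_le {Ω : Type*} [MeasurableSpace Ω] {μ : Measure Ω}
    [SFinite μ] {d : ℕ} {η : Ω → Fin d → ℝ} {S : Matrix (Fin d) (Fin d) ℝ}
    (h : LaplaceBound μ η S) (hη : Measurable η) (hS : S.PosSemidef) {L s : ℝ}
    (hL : ∀ v, v ⬝ᵥ S *ᵥ v ≤ L * (v ⬝ᵥ v)) (hs : 0 ≤ s) (hsL : 4 * (s * L) ≤ 1) :
    ∫⁻ ω, ENNReal.ofReal (Real.exp (s * (η ω ⬝ᵥ η ω))) ∂μ ≤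
      ENNReal.ofReal (Real.exp (2 * s * S.trace)) := by
  obtain ⟨Q, l, h1, h2, hSe, hl0, htr, -⟩ := exists_orthogonal_diagonal hS
  have hlL : ∀ j, l j ≤ L := by
    intro j
    have := hL (Q *ᵥ Pi.single j 1)
    rw [dotProduct_mulVec_orthogonal_diagonal h2 hSe, dotProduct_orthogonal_mulVec h2] at this
    simpa [Pi.single_apply, Finset.sum_ite_eq'] using this
  have key : ∀ ω, ENNReal.ofReal (Real.exp (s * (η ω ⬝ᵥ η ω))) =
      ∫⁻ g, ENNReal.ofReal (Real.exp (η ω ⬝ᵥ (Q *ᵥ (√(2 * s) • g))))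
        ∂Measure.pi (fun _ : Fin d => gaussianReal 0 1) := by
    intro ω
    have e1 : ∀ g : Fin d → ℝ, η ω ⬝ᵥ (Q *ᵥ (√(2 * s) • g)) =
        ∑ j, (√(2 * s) * (Qᵀ *ᵥ η ω) j) * g j := by
      intro g
      rw [dotProduct_mulVec, ← mulVec_transpose, dotProduct]
      exact Finset.sum_congr rfl fun j _ => by simp; ring
    simp_rw [e1, ofReal_exp_sum]
    rw [lintegral_pi_prod (fun _ : Fin d => gaussianReal 0 1)
      (f := fun j x => ENNReal.ofReal (Real.exp (√(2 * s) * (Qᵀ *ᵥ η ω) j * x)))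
      (fun j => by fun_prop)]
    simp_rw [lintegral_exp_gaussianReal]
    rw [← ofReal_exp_sum]
    congr 2
    have : η ω ⬝ᵥ η ω = (Qᵀ *ᵥ η ω) ⬝ᵥ (Qᵀ *ᵥ η ω) :=
      (dotProduct_orthogonal_mulVec (by simpa using h1) _).symm
    rw [this, dotProduct, Finset.mul_sum]
    refine Finset.sum_congr rfl fun j _ => ?_
    rw [mul_pow, Real.sq_sqrt (by positivity)]; ring
  simp_rw [key]
  rw [lintegral_lintegral_swap]
  · calc ∫⁻ g, ∫⁻ ω, ENNReal.ofReal (Real.exp (η ω ⬝ᵥ (Q *ᵥ (√(2 * s) • g)))) ∂μ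
          ∂Measure.pi (fun _ : Fin d => gaussianReal 0 1)
        ≤ ∫⁻ g, ∏ j, ENNReal.ofReal (Real.exp (s * l j * g j ^ 2))
          ∂Measure.pi (fun _ : Fin d => gaussianReal 0 1) := by
          refine lintegral_mono fun g => (h _).trans_eq ?_
          rw [dotProduct_mulVec_orthogonal_diagonal h2 hSe, ← ofReal_exp_sum, Finset.sum_div]
          congr 2
          refine Finset.sum_congr rfl fun j _ => ?_
          rw [Pi.smul_apply, smul_eq_mul, mul_pow, Real.sq_sqrt (by positivity)]; ring
      _ = ∏ j, ∫⁻ x, ENNReal.ofReal (Real.exp (s * l j * x ^ 2)) ∂gaussianReal 0 1 :=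
          lintegral_pi_prod (fun _ : Fin d => gaussianReal 0 1)
            (f := fun j x => ENNReal.ofReal (Real.exp (s * l j * x ^ 2))) (fun j => by fun_prop)
      _ ≤ ∏ j, ENNReal.ofReal (Real.exp (2 * (s * l j))) := by
          refine Finset.prod_le_prod' fun j _ =>
            lintegral_exp_sq_gaussianReal_le (mul_nonneg hs (hl0 j)) ?_
          have := mul_le_mul_of_nonneg_left (hlL j) hs
          linarith
      _ = _ := by
          rw [← ofReal_exp_sum, htr, Finset.mul_sum]
          congr 2
          exact Finset.sum_congr rfl fun j _ => by ring
  · refine (ENNReal.measurable_ofReal.comp (Real.measurable_exp.comp ?_)).aemeasurable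
    simp only [dotProduct, mulVec, Pi.smul_apply, smul_eq_mul]
    fun_prop

/-- Chernoff's bound at `s = 1/(4L)`, the largest exponent allowed by the preceding lemma. -/
theorem LaplaceBound.measure_sq_gt_le_of_pos {Ω : Type*} [MeasurableSpace Ω] {μ : Measure Ω}
    [SFinite μ] {d : ℕ} {η : Ω → Fin d → ℝ} {S : Matrix (Fin d) (Fin d) ℝ}
    (h : LaplaceBound μ η S) (hη : Measurable η) (hS : S.PosSemidef) {L : ℝ}
    (hL : ∀ v, v ⬝ᵥ S *ᵥ v ≤ L * (v ⬝ᵥ v)) (hL0 : 0 < L) (t : ℝ) :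
    μ {ω | 2 * S.trace + 4 * L * t < η ω ⬝ᵥ η ω} ≤ ENNReal.ofReal (Real.exp (-t)) := by
  set s := (4 * L)⁻¹ with hs
  have hb := h.lintegral_exp_sq_le hη hS hL (s := s) (by positivity)
    (by rw [hs]; field_simp; rfl)
  have hm : Measurable fun ω => ENNReal.ofReal (Real.exp (s * (η ω ⬝ᵥ η ω))) := by
    refine ENNReal.measurable_ofReal.comp (Real.measurable_exp.comp ?_)
    simp only [dotProduct]
    fun_prop
  set a := ENNReal.ofReal (Real.exp (2 * s * S.trace + t)) with ha
  have hsub : {ω | 2 * S.trace + 4 * L * t < η ω ⬝ᵥ η ω} ⊆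
      {ω | a ≤ ENNReal.ofReal (Real.exp (s * (η ω ⬝ᵥ η ω)))} := by
    intro ω hω
    refine ENNReal.ofReal_le_ofReal (Real.exp_le_exp.2 ?_)
    have := mul_le_mul_of_nonneg_left (le_of_lt hω) (show 0 ≤ s by positivity)
    have e : s * (4 * L) = 1 := by rw [hs]; field_simp
    linear_combination this - t * e
  have ha0 : a ≠ 0 := by simp [ha, Real.exp_pos]
  calc μ _ ≤ μ {ω | a ≤ ENNReal.ofReal (Real.exp (s * (η ω ⬝ᵥ η ω)))} := measure_mono hsub
    _ ≤ (∫⁻ ω, ENNReal.ofReal (Real.exp (s * (η ω ⬝ᵥ η ω))) ∂μ) / a :=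
        meas_ge_le_lintegral_div hm.aemeasurable ha0 (by simp [ha])
    _ ≤ ENNReal.ofReal (Real.exp (2 * s * S.trace)) / a := by gcongr
    _ = _ := by
        rw [ha, ← ENNReal.ofReal_div_of_pos (Real.exp_pos _), ← Real.exp_sub]
        congr 2; ring

/-- Extends the bound to `L = 0`, where no Chernoff exponent can be named: replace `L` by `L +
1/(m+1)` and let the events increase to the desired one. -/
theorem LaplaceBound.measure_sq_gt_le {Ω : Type*} [MeasurableSpace Ω] {μ : Measure Ω}
    [SFinite μ] {d : ℕ} {η : Ω → Fin d → ℝ} {S : Matrix (Fin d) (Fin d) ℝ}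
    (h : LaplaceBound μ η S) (hη : Measurable η) (hS : S.PosSemidef) {L : ℝ}
    (hL : ∀ v, v ⬝ᵥ S *ᵥ v ≤ L * (v ⬝ᵥ v)) (hL0 : 0 ≤ L) {t : ℝ} (ht : 0 ≤ t) :
    μ {ω | 2 * S.trace + 4 * L * t < η ω ⬝ᵥ η ω} ≤ ENNReal.ofReal (Real.exp (-t)) := by
  set B : ℕ → Set Ω := fun m => {ω | 2 * S.trace + 4 * (L + 1 / (m + 1)) * t < η ω ⬝ᵥ η ω}
  have hmono : Monotone B := by
    intro m m' hm ω hω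
    have hω' : 2 * S.trace + 4 * (L + 1 / (m + 1)) * t < η ω ⬝ᵥ η ω := hω
    refine lt_of_le_of_lt ?_ hω'
    have : (1 : ℝ) / (m' + 1) ≤ 1 / (m + 1) := Nat.one_div_le_one_div hm
    gcongr
  have hU : {ω | 2 * S.trace + 4 * L * t < η ω ⬝ᵥ η ω} ⊆ ⋃ m, B m := by
    intro ω hω
    have hlim : Filter.Tendsto (fun m : ℕ => 2 * S.trace + 4 * (L + 1 / ((m : ℝ) + 1)) * t)
        Filter.atTop (nhds (2 * S.trace + 4 * (L + 0) * t)) :=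
      ((((tendsto_one_div_add_atTop_nhds_zero_nat (𝕜 := ℝ)).const_add L).const_mul 4).mul_const
        t).const_add _
    rw [add_zero] at hlim
    obtain ⟨m, hm⟩ := (hlim.eventually_lt_const hω).exists
    exact Set.mem_iUnion.2 ⟨m, hm⟩
  refine (measure_mono hU).trans ?_
  rw [hmono.measure_iUnion]
  refine iSup_le fun m => h.measure_sq_gt_le_of_pos hη hS (fun v => (hL v).trans ?_)
    (by positivity) t
  gcongr
  · exact Finset.sum_nonneg fun i _ => mul_self_nonneg _
  · simp; positivity

/-! ### Samples of independent sub-Gaussian vectors -/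

theorem dotProduct_self_nonneg' {ι : Type*} [Fintype ι] (v : ι → ℝ) : 0 ≤ v ⬝ᵥ v :=
  Finset.sum_nonneg fun _ _ => mul_self_nonneg _

theorem LaplaceBound.mulVec {Ω : Type*} [MeasurableSpace Ω] {μ : Measure Ω} {d m : ℕ}
    {η : Ω → Fin d → ℝ} {S : Matrix (Fin d) (Fin d) ℝ} (h : LaplaceBound μ η S)
    (G : Matrix (Fin m) (Fin d) ℝ) :
    LaplaceBound μ (fun ω => G *ᵥ η ω) (G * S * Gᵀ) := by
  intro v
  have h1 : ∀ ω, (G *ᵥ η ω) ⬝ᵥ v = η ω ⬝ᵥ (Gᵀ *ᵥ v) := fun ω => by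
    rw [dotProduct_comm, dotProduct_mulVec, mulVec_transpose, dotProduct_comm]
  have h2 : v ⬝ᵥ (G * S * Gᵀ) *ᵥ v = (Gᵀ *ᵥ v) ⬝ᵥ S *ᵥ (Gᵀ *ᵥ v) := by
    rw [Matrix.mul_assoc, ← mulVec_mulVec, dotProduct_mulVec, ← mulVec_mulVec,
      mulVec_transpose]
  simp_rw [h1, h2]
  exact h _

/-- The vector is `∑ uᵢ f(ωᵢ)` with independent summands, so the covariance proxies `uᵢ² S` add up.
-/
theorem LaplaceBound.weightedSum {α : Type*} [MeasurableSpace α] {μ : Measure α}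
    [IsProbabilityMeasure μ] {n d : ℕ} {f : α → Fin d → ℝ} {S : Matrix (Fin d) (Fin d) ℝ}
    (h : LaplaceBound μ f S) (hf : Measurable f) (u : Fin n → ℝ) :
    LaplaceBound (Measure.pi fun _ : Fin n => μ) (fun ω => (of fun i => f (ω i))ᵀ *ᵥ u)
      ((u ⬝ᵥ u) • S) := by
  intro v
  have h1 : ∀ ω : Fin n → α, ((of fun i => f (ω i))ᵀ *ᵥ u) ⬝ᵥ v = ∑ i, f (ω i) ⬝ᵥ (u i • v) := by
    intro ω
    rw [mulVec_transpose, ← dotProduct_mulVec, dotProduct]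
    refine Finset.sum_congr rfl fun i _ => ?_
    rw [dotProduct_smul]; rfl
  simp_rw [h1, ofReal_exp_sum]
  rw [lintegral_pi_prod (fun _ : Fin n => μ)
    (f := fun i a => ENNReal.ofReal (Real.exp (f a ⬝ᵥ (u i • v))))
    (fun i => by simp only [dotProduct]; fun_prop)]
  refine (Finset.prod_le_prod' fun i _ => h _).trans_eq ?_
  rw [← ofReal_exp_sum]
  congr 2
  rw [smul_mulVec, dotProduct_smul, show u ⬝ᵥ u = ∑ i, u i * u i from rfl, smul_eq_mul, Finset.sum_mul,
    Finset.sum_div]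
  refine Finset.sum_congr rfl fun i _ => ?_
  rw [mulVec_smul, dotProduct_smul, smul_dotProduct]
  simp; ring

theorem laplaceBound_pi {α : Type*} [MeasurableSpace α] {μ : Measure α}
    [IsProbabilityMeasure μ] {n : ℕ} {x : α → ℝ} {c : ℝ} (hx : Measurable x)
    (h : ∀ t, ∫⁻ a, ENNReal.ofReal (Real.exp (t * x a)) ∂μ ≤
      ENNReal.ofReal (Real.exp (c * t ^ 2 / 2))) :
    LaplaceBound (Measure.pi fun _ : Fin n => μ) (fun ω i => x (ω i)) (c • 1) := by
  intro v
  simp_rw [dotProduct, ofReal_exp_sum]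
  rw [lintegral_pi_prod (fun _ : Fin n => μ)
    (f := fun i a => ENNReal.ofReal (Real.exp (x a * v i))) (fun i => by fun_prop)]
  simp_rw [mul_comm (x _)]
  refine (Finset.prod_le_prod' fun i _ => h _).trans_eq ?_
  rw [← ofReal_exp_sum, Finset.sum_div]
  congr 2
  refine Finset.sum_congr rfl fun i _ => ?_
  simp [smul_mulVec]; ring

theorem LaplaceBound.project {α : Type*} [MeasurableSpace α] {μ : Measure α} {d : ℕ}
    {f : α → Fin d → ℝ} {S : Matrix (Fin d) (Fin d) ℝ} (h : LaplaceBound μ f S)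
    (v : Fin d → ℝ) (t : ℝ) :
    ∫⁻ a, ENNReal.ofReal (Real.exp (t * (f a ⬝ᵥ v))) ∂μ ≤
      ENNReal.ofReal (Real.exp ((v ⬝ᵥ S *ᵥ v) * t ^ 2 / 2)) := by
  have := h (t • v)
  simp only [dotProduct_smul, mulVec_smul, smul_dotProduct, smul_eq_mul] at this
  refine this.trans_eq ?_
  congr 2; ring

/-- Deviation bound for `‖𝐖 v‖²` at a fixed vector `v`. -/
theorem LaplaceBound.measure_rows_mulVec_gt_le {α : Type*} [MeasurableSpace α] {μ : Measure α}
    [IsProbabilityMeasure μ] {n d : ℕ} {f : α → Fin d → ℝ} {S : Matrix (Fin d) (Fin d) ℝ}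
    (h : LaplaceBound μ f S) (hf : Measurable f) (v : Fin d → ℝ) (hv : 0 ≤ v ⬝ᵥ S *ᵥ v)
    {t : ℝ} (ht : 0 ≤ t) :
    (Measure.pi fun _ : Fin n => μ) {ω | (v ⬝ᵥ S *ᵥ v) * (2 * n + 4 * t) <
      ((of fun i => f (ω i)) *ᵥ v) ⬝ᵥ ((of fun i => f (ω i)) *ᵥ v)} ≤
      ENNReal.ofReal (Real.exp (-t)) := by
  have hm : Measurable fun a => f a ⬝ᵥ v := by simp only [dotProduct]; fun_prop
  have h1 := laplaceBound_pi (n := n) hm (h.project v)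
  have h2 := h1.measure_sq_gt_le (by fun_prop)
    (PosSemidef.one.smul hv) (L := v ⬝ᵥ S *ᵥ v)
    (fun w => by simp [smul_mulVec]) hv ht
  refine le_trans (measure_mono fun ω hω => ?_) h2
  simp only [Set.mem_ofPred_eq, trace_smul, trace_one, Fintype.card_fin, smul_eq_mul] at hω ⊢
  refine lt_of_le_of_lt (le_of_eq ?_) hω
  ring

/-! ### Nets -/

/-- Take a largest `1`-separated subset of the ball of radius `2` and halve it; the volume packing
bound gives `5 ^ d`. -/
theorem exists_half_net (d : ℕ) : ∃ N : Finset (EuclideanSpace ℝ (Fin d)), N.card ≤ 5 ^ d ∧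
    (∀ y ∈ N, ‖y‖ ≤ 1) ∧ ∀ x, ‖x‖ ≤ 1 → ∃ y ∈ N, ‖x - y‖ ≤ 1 / 2 := by
  classical
  let E := EuclideanSpace ℝ (Fin d)
  let Q : Finset E → Prop := fun s => (∀ c ∈ s, ‖c‖ ≤ 2) ∧
    ∀ c ∈ s, ∀ e ∈ s, c ≠ e → 1 ≤ ‖c - e‖
  have hcard : ∀ s, Q s → s.card ≤ 5 ^ d := fun s hs => by
    simpa [E] using Besicovitch.card_le_of_separated s hs.1 hs.2
  let T : Set ℕ := {m | ∃ s, Q s ∧ s.card = m}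
  have hT : BddAbove T := ⟨5 ^ d, by rintro m ⟨s, hs, rfl⟩; exact hcard s hs⟩
  have hne : T.Nonempty := ⟨0, ∅, by simp [Q], rfl⟩
  obtain ⟨s, hs, hsm⟩ := Nat.sSup_mem hne hT
  refine ⟨s.image fun c => (1 / 2 : ℝ) • c, Finset.card_image_le.trans (hcard s hs), ?_, ?_⟩
  · intro y hy
    obtain ⟨c, hc, rfl⟩ := Finset.mem_image.1 hy
    have := hs.1 c hc
    rw [norm_smul]; norm_num; linarith
  · intro x hx
    by_contra! hcon
    have hfar : ∀ c ∈ s, 1 < ‖(2 : ℝ) • x - c‖ := by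
      intro c hc
      have h1 := hcon _ (Finset.mem_image_of_mem _ hc)
      have h2 : (2 : ℝ) • x - c = (2 : ℝ) • (x - (1 / 2 : ℝ) • c) := by
        rw [smul_sub, smul_smul]; norm_num
      rw [h2, norm_smul]; norm_num at h1 ⊢; linarith
    have hnot : (2 : ℝ) • x ∉ s := fun h => by
      have := hfar _ h
      norm_num at this
    -- An uncovered `x` would allow `2x` to be added to `s`, against maximality.
    have hQ : Q (insert ((2 : ℝ) • x) s) := by
      refine ⟨?_, ?_⟩
      · intro c hc
        rcases Finset.mem_insert.1 hc with rfl | hc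
        · rw [norm_smul]; norm_num; linarith
        · exact hs.1 c hc
      · intro c hc e he hce
        rcases Finset.mem_insert.1 hc with rfl | hc <;> rcases Finset.mem_insert.1 he with rfl | he
        · exact absurd rfl hce
        · exact (hfar e he).le
        · rw [norm_sub_rev]; exact (hfar c hc).le
        · exact hs.2 c hc e he hce
    have := le_csSup hT ⟨_, hQ, rfl⟩
    rw [Finset.card_insert_of_notMem hnot, hsm] at this
    omega

/-- Each refinement approximates the remainder `x - y`, blown up by `2 ^ j` into the unit ball, by
the half-net. -/
theorem exists_dyadic_net (d j : ℕ) : ∃ N : Finset (EuclideanSpace ℝ (Fin d)),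
    N.card ≤ 5 ^ (j * d) ∧ ∀ x, ‖x‖ ≤ 1 → ∃ y ∈ N, ‖x - y‖ ≤ (1 / 2) ^ j := by
  classical
  obtain ⟨H, hHc, -, hH⟩ := exists_half_net d
  induction j with
  | zero => exact ⟨{0}, by simp, fun x hx => ⟨0, by simp, by simpa using hx⟩⟩
  | succ j ih =>
    obtain ⟨N, hNc, hN⟩ := ih
    refine ⟨(N ×ˢ H).image fun q => q.1 + ((1 / 2 : ℝ) ^ j) • q.2, ?_, ?_⟩
    · refine Finset.card_image_le.trans ?_
      rw [Finset.card_product, add_mul, one_mul, pow_add]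
      exact Nat.mul_le_mul hNc hHc
    · intro x hx
      obtain ⟨y, hy, hxy⟩ := hN x hx
      obtain ⟨z, hz, hyz⟩ := hH ((2 : ℝ) ^ j • (x - y)) (by
        rw [norm_smul, norm_pow, Real.norm_ofNat]
        calc (2 : ℝ) ^ j * ‖x - y‖ ≤ 2 ^ j * (1 / 2) ^ j := by gcongr
          _ = 1 := by rw [← mul_pow]; norm_num)
      refine ⟨_, Finset.mem_image_of_mem _ (Finset.mk_mem_product hy hz), ?_⟩
      have e : x - (y + ((1 / 2 : ℝ) ^ j) • z) =
          ((1 / 2 : ℝ) ^ j) • ((2 : ℝ) ^ j • (x - y) - z) := by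
        rw [smul_sub, smul_smul, ← mul_pow]; norm_num; abel
      rw [e, norm_smul, norm_pow, pow_succ]
      norm_num at hyz ⊢
      gcongr

/-- Self-bounding: `‖T‖ ≤ b + ‖T‖/2`. -/
theorem opNorm_le_of_half_net {E F : Type*} [NormedAddCommGroup E] [NormedSpace ℝ E]
    [NormedAddCommGroup F] [NormedSpace ℝ F] (T : E →L[ℝ] F) {N : Finset E} {b : ℝ} (hb : 0 ≤ b)
    (hN : ∀ x, ‖x‖ ≤ 1 → ∃ y ∈ N, ‖x - y‖ ≤ 1 / 2) (hT : ∀ y ∈ N, ‖T y‖ ≤ b) :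
    ‖T‖ ≤ 2 * b := by
  have h : ‖T‖ ≤ b + ‖T‖ * (1 / 2) := by
    refine T.opNorm_le_of_unit_norm (by positivity) fun x hx => ?_
    obtain ⟨y, hy, hxy⟩ := hN x hx.le
    calc ‖T x‖ = ‖T y + T (x - y)‖ := by rw [← map_add]; congr 2; abel
      _ ≤ ‖T y‖ + ‖T (x - y)‖ := norm_add_le _ _
      _ ≤ b + ‖T‖ * (1 / 2) := add_le_add (hT y hy) (T.le_opNorm_of_le hxy)
  linarith

theorem norm_toLp_sq {d : ℕ} (v : Fin d → ℝ) : ‖WithLp.toLp 2 v‖ ^ 2 = v ⬝ᵥ v := by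
  rw [EuclideanSpace.norm_sq_eq, dotProduct]
  exact Finset.sum_congr rfl fun i _ => by simp [sq]

theorem norm_sq_eq_dotProduct {d : ℕ} (x : EuclideanSpace ℝ (Fin d)) :
    ‖x‖ ^ 2 = x.ofLp ⬝ᵥ x.ofLp := norm_toLp_sq x.ofLp

theorem sq_mulVec_le_of_half_net {m d : ℕ} (G : Matrix (Fin m) (Fin d) ℝ)
    {N : Finset (EuclideanSpace ℝ (Fin d))} {b : ℝ} (hb : 0 ≤ b)
    (hN : ∀ x, ‖x‖ ≤ 1 → ∃ y ∈ N, ‖x - y‖ ≤ 1 / 2)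
    (hG : ∀ y ∈ N, (G *ᵥ y.ofLp) ⬝ᵥ (G *ᵥ y.ofLp) ≤ b) (v : Fin d → ℝ) :
    (G *ᵥ v) ⬝ᵥ (G *ᵥ v) ≤ 4 * b * (v ⬝ᵥ v) := by
  let T : EuclideanSpace ℝ (Fin d) →L[ℝ] EuclideanSpace ℝ (Fin m) :=
    (Matrix.toEuclideanLin G).toContinuousLinearMap
  have hTn : ∀ y, ‖T y‖ ^ 2 = (G *ᵥ y.ofLp) ⬝ᵥ (G *ᵥ y.ofLp) := fun y => norm_sq_eq_dotProduct _
  have h1 := opNorm_le_of_half_net T (Real.sqrt_nonneg b) hN fun y hy =>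
    Real.le_sqrt_of_sq_le ((hTn y).trans_le (hG y hy))
  have h2 := hTn (WithLp.toLp 2 v)
  have h3 : ‖T (WithLp.toLp 2 v)‖ ≤ 2 * √b * ‖WithLp.toLp 2 v‖ := T.le_of_opNorm_le h1 _
  have h4 := pow_le_pow_left₀ (norm_nonneg _) h3 2
  rw [h2, mul_pow, norm_toLp_sq, mul_pow, Real.sq_sqrt hb] at h4
  norm_num at h4
  exact h4

/-- Cauchy–Schwarz on `‖Gv‖² = ⟨v, GᵀGv⟩` gives `‖Gv‖⁴ ≤ ‖v‖² · b‖Gv‖²`. -/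
theorem sq_mulVec_le_of_transpose {m d : ℕ} (G : Matrix (Fin m) (Fin d) ℝ) {b : ℝ}
    (hb : 0 ≤ b) (hG : ∀ u, (Gᵀ *ᵥ u) ⬝ᵥ (Gᵀ *ᵥ u) ≤ b * (u ⬝ᵥ u)) (v : Fin d → ℝ) :
    (G *ᵥ v) ⬝ᵥ (G *ᵥ v) ≤ b * (v ⬝ᵥ v) := by
  set a := (G *ᵥ v) ⬝ᵥ (G *ᵥ v) with ha
  have h1 : a = v ⬝ᵥ (Gᵀ *ᵥ (G *ᵥ v)) := by
    rw [ha, dotProduct_mulVec, mulVec_transpose, dotProduct_comm]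
  have h2 : a ^ 2 ≤ (v ⬝ᵥ v) * (b * a) := by
    calc a ^ 2 ≤ (v ⬝ᵥ v) * ((Gᵀ *ᵥ (G *ᵥ v)) ⬝ᵥ (Gᵀ *ᵥ (G *ᵥ v))) := by
          rw [h1]
          simp only [dotProduct, ← sq]
          exact Finset.sum_mul_sq_le_sq_mul_sq _ _ _
      _ ≤ _ := mul_le_mul_of_nonneg_left (hG _) (dotProduct_self_nonneg' v)
  have ha0 : 0 ≤ a := dotProduct_self_nonneg' _
  rcases ha0.eq_or_lt with h0 | h0
  · rw [← h0] at h1 ⊢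
    exact mul_nonneg hb (dotProduct_self_nonneg' v)
  · have : a * a ≤ a * (b * (v ⬝ᵥ v)) := by nlinarith
    exact le_of_mul_le_mul_left this h0

/-- The operator norm of a matrix with independent sub-Gaussian rows. -/
theorem LaplaceBound.measure_rows_opNorm_le {α : Type*} [MeasurableSpace α] {μ : Measure α}
    [IsProbabilityMeasure μ] {n d : ℕ} {f : α → Fin d → ℝ} {S : Matrix (Fin d) (Fin d) ℝ}
    (h : LaplaceBound μ f S) (hf : Measurable f) (hS : S.PosSemidef) {L : ℝ} (hL0 : 0 ≤ L)
    (hL : ∀ v, v ⬝ᵥ S *ᵥ v ≤ L * (v ⬝ᵥ v)) :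
    (Measure.pi fun _ : Fin n => μ) {ω | ¬ ∀ v,
      ((of fun i => f (ω i)) *ᵥ v) ⬝ᵥ ((of fun i => f (ω i)) *ᵥ v) ≤
        (8 * S.trace + 48 * n * L) * (v ⬝ᵥ v)} ≤
      ENNReal.ofReal (Real.exp (-n)) := by
  -- The net lives in the sample space `ℝⁿ` and is tested against the transpose, so the dimension
  -- `d` enters only through `tr S`.
  obtain ⟨N, hNc, hN1, hN⟩ := exists_half_net n
  -- The deviation level at `t = 3n`; the passage from net to ball multiplies it by `4`.
  set b := 2 * S.trace + 12 * n * L with hb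
  have htr : 0 ≤ S.trace := hS.trace_nonneg
  have hb0 : 0 ≤ b := by positivity
  have hsub : {ω : Fin n → α | ¬ ∀ v,
      ((of fun i => f (ω i)) *ᵥ v) ⬝ᵥ ((of fun i => f (ω i)) *ᵥ v) ≤
        (8 * S.trace + 48 * n * L) * (v ⬝ᵥ v)} ⊆
      ⋃ y ∈ N, {ω | b < ((of fun i => f (ω i))ᵀ *ᵥ y.ofLp) ⬝ᵥ
        ((of fun i => f (ω i))ᵀ *ᵥ y.ofLp)} := by
    intro ω hω
    by_contra hcon
    simp only [Set.mem_iUnion, Set.mem_ofPred_eq, exists_prop, not_exists, not_and, not_lt] at hcon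
    refine hω fun v => ?_
    have h1 := sq_mulVec_le_of_transpose (of fun i => f (ω i)) (by positivity)
      (sq_mulVec_le_of_half_net _ hb0 hN hcon) v
    refine h1.trans_eq ?_
    rw [hb]; ring
  refine (measure_mono hsub).trans ((measure_biUnion_finset_le _ _).trans ?_)
  have hy : ∀ y ∈ N, (Measure.pi fun _ : Fin n => μ)
      {ω | b < ((of fun i => f (ω i))ᵀ *ᵥ y.ofLp) ⬝ᵥ ((of fun i => f (ω i))ᵀ *ᵥ y.ofLp)} ≤
      ENNReal.ofReal (Real.exp (-(3 * n))) := by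
    intro y hy
    have hy1 : y.ofLp ⬝ᵥ y.ofLp ≤ 1 := by
      rw [← norm_sq_eq_dotProduct]
      exact pow_le_one₀ (norm_nonneg _) (hN1 y hy)
    have hy0 := dotProduct_self_nonneg' y.ofLp
    have h1 := (h.weightedSum hf y.ofLp).measure_sq_gt_le (L := L) (t := 3 * n) (by
        refine measurable_pi_lambda _ fun j => ?_
        simp only [Matrix.mulVec, dotProduct, transpose_apply, of_apply]
        fun_prop)
      (hS.smul hy0) (fun v => by
        rw [smul_mulVec, dotProduct_smul, smul_eq_mul]
        have := hL v
        have h0 := hS.dotProduct_mulVec_nonneg v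
        simp only [star_trivial] at h0
        nlinarith) hL0 (by positivity)
    refine le_trans (measure_mono fun ω hω => ?_) h1
    simp only [Set.mem_ofPred_eq, trace_smul, smul_eq_mul] at hω ⊢
    refine lt_of_le_of_lt ?_ hω
    rw [hb]
    nlinarith
  refine (Finset.sum_le_sum hy).trans ?_
  rw [Finset.sum_const, nsmul_eq_mul]
  calc (N.card : ℝ≥0∞) * ENNReal.ofReal (Real.exp (-(3 * n)))
      ≤ ENNReal.ofReal (Real.exp (2 * n)) * ENNReal.ofReal (Real.exp (-(3 * n))) := by
        gcongr
        rw [← ENNReal.ofReal_natCast]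
        apply ENNReal.ofReal_le_ofReal
        -- The net has at most `5ⁿ ≤ e²ⁿ` points, so tails `e⁻³ⁿ` leave `e⁻ⁿ`.
        have h5 : (5 : ℝ) ≤ Real.exp 2 := by
          have := Real.quadratic_le_exp_of_nonneg (x := 2) (by norm_num)
          linarith
        calc (N.card : ℝ) ≤ 5 ^ n := by exact_mod_cast hNc
          _ ≤ (Real.exp 2) ^ n := by gcongr
          _ = Real.exp (2 * n) := by rw [← Real.exp_nat_mul]; ring_nf
    _ = _ := by
        rw [← ENNReal.ofReal_mul (Real.exp_pos _).le, ← Real.exp_add]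
        congr 2; ring

/-! ### The smallest singular value of an isotropic sub-Gaussian sample -/

/-- `(1 - u + u²/2)(1 + u + u²/2) = 1 + u⁴/4 ≥ 1`, and the second factor is at most `eᵘ`. -/
theorem exp_neg_le_quadratic {u : ℝ} (hu : 0 ≤ u) : Real.exp (-u) ≤ 1 - u + u ^ 2 / 2 := by
  rw [Real.exp_neg, inv_le_iff_one_le_mul₀ (Real.exp_pos _)]
  have h := Real.quadratic_le_exp_of_nonneg hu
  have h2 : 0 < 1 - u + u ^ 2 / 2 := by nlinarith [sq_nonneg (u - 1)]
  calc (1 : ℝ) ≤ (1 - u + u ^ 2 / 2) * (1 + u + u ^ 2 / 2) := by nlinarith [sq_nonneg (u ^ 2)]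
    _ ≤ _ := mul_le_mul_of_nonneg_left h h2.le

/-- With `u = x²/(4c)`, `x⁴ = 32c² · u²/2 ≤ 32c² eᵘ`, and the quadratic exponential bound gives `E
eᵘ ≤ e^{1/2} ≤ 2`. -/
theorem lintegral_pow_four_le {α : Type*} [MeasurableSpace α] {μ : Measure α}
    [IsProbabilityMeasure μ] {x : α → ℝ} {c : ℝ} (hc : 0 < c) (hx : Measurable x)
    (h : ∀ t, ∫⁻ a, ENNReal.ofReal (Real.exp (t * x a)) ∂μ ≤
      ENNReal.ofReal (Real.exp (c * t ^ 2 / 2))) :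
    ∫⁻ a, ENNReal.ofReal (x a ^ 4) ∂μ ≤ ENNReal.ofReal (64 * c ^ 2) := by
  have hb : LaplaceBound μ (fun a (_ : Fin 1) => x a) (c • 1) := by
    intro v
    have := h (v 0)
    simp only [dotProduct, Finset.univ_unique, Fin.default_eq_zero, Fin.isValue,
      Finset.sum_singleton, smul_mulVec, one_mulVec, Pi.smul_apply, smul_eq_mul]
    simp_rw [mul_comm (x _)]
    refine this.trans_eq ?_
    congr 2; ring
  have h1 := hb.lintegral_exp_sq_le (by fun_prop) (PosSemidef.one.smul hc.le) (L := c)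
    (s := (4 * c)⁻¹) (fun w => by simp [smul_mulVec]) (by positivity) (by field_simp; rfl)
  have h2 : ∀ a, ENNReal.ofReal (x a ^ 4) ≤ ENNReal.ofReal (32 * c ^ 2) *
      ENNReal.ofReal (Real.exp ((4 * c)⁻¹ * ((fun _ : Fin 1 => x a) ⬝ᵥ fun _ => x a))) := by
    intro a
    rw [← ENNReal.ofReal_mul (by positivity)]
    apply ENNReal.ofReal_le_ofReal
    have e : (4 * c)⁻¹ * ((fun _ : Fin 1 => x a) ⬝ᵥ fun _ => x a) = x a ^ 2 / (4 * c) := by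
      simp [dotProduct]; ring
    rw [e]
    have hu : 0 ≤ x a ^ 2 / (4 * c) := by positivity
    have := Real.quadratic_le_exp_of_nonneg hu
    calc x a ^ 4 = 32 * c ^ 2 * ((x a ^ 2 / (4 * c)) ^ 2 / 2) := by field_simp; ring
      _ ≤ _ := by gcongr; linarith
  calc _ ≤ ∫⁻ a, ENNReal.ofReal (32 * c ^ 2) *
      ENNReal.ofReal (Real.exp ((4 * c)⁻¹ * ((fun _ : Fin 1 => x a) ⬝ᵥ fun _ => x a))) ∂μ :=
        lintegral_mono h2
    _ ≤ ENNReal.ofReal (32 * c ^ 2) * ENNReal.ofReal (Real.exp (1 / 2)) := by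
        rw [lintegral_const_mul _ (by simp only [dotProduct]; fun_prop)]
        gcongr
        refine h1.trans_eq ?_
        congr 2
        simp
        field_simp
        norm_num
    _ ≤ _ := by
        rw [← ENNReal.ofReal_mul (by positivity)]
        apply ENNReal.ofReal_le_ofReal
        have : Real.exp (1 / 2) ≤ 2 := by
          have h3 := Real.exp_bound_div_one_sub_of_interval (x := 1 / 2) (by norm_num) (by norm_num)
          norm_num at h3 ⊢
          exact h3
        nlinarith [sq_nonneg c]

/-- Because `x²` is nonnegative, its lower tail is controlled by two moments of `x²` alone, through
`e⁻ᵘ ≤ 1 - u + u²/2`. -/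
theorem lintegral_exp_neg_sq_le {α : Type*} [MeasurableSpace α] {μ : Measure α}
    [IsProbabilityMeasure μ] {x : α → ℝ} (hx : Measurable x) (hx2 : MemLp x 2 μ)
    (h1 : ∫ a, x a ^ 2 ∂μ = 1) {M : ℝ} (hM : 0 ≤ M)
    (h4 : ∫⁻ a, ENNReal.ofReal (x a ^ 4) ∂μ ≤ ENNReal.ofReal M) {s : ℝ} (hs : 0 ≤ s) :
    ∫⁻ a, ENNReal.ofReal (Real.exp (-(s * x a ^ 2))) ∂μ ≤
      ENNReal.ofReal (Real.exp (-s + s ^ 2 * M / 2)) := by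
  have hi4 : Integrable (fun a => x a ^ 4) μ := by
    refine ⟨by fun_prop, ?_⟩
    rw [hasFiniteIntegral_iff_ofReal (ae_of_all _ fun a => by positivity)]
    exact h4.trans_lt ENNReal.ofReal_lt_top
  have hi2 : Integrable (fun a => x a ^ 2) μ := hx2.integrable_sq
  have h4' : ∫ a, x a ^ 4 ∂μ ≤ M := by
    rw [← ofReal_integral_eq_lintegral_ofReal hi4 (ae_of_all _ fun a => by positivity)] at h4
    exact (ENNReal.ofReal_le_ofReal_iff hM).1 h4
  have hint : Integrable (fun a => 1 - s * x a ^ 2 + s ^ 2 / 2 * x a ^ 4) μ :=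
    ((integrable_const _).sub (hi2.const_mul _)).add (hi4.const_mul _)
  have hp : ∀ a, Real.exp (-(s * x a ^ 2)) ≤ 1 - s * x a ^ 2 + s ^ 2 / 2 * x a ^ 4 := fun a => by
    refine (exp_neg_le_quadratic (u := s * x a ^ 2) (by positivity)).trans_eq ?_
    ring
  calc _ ≤ ∫⁻ a, ENNReal.ofReal (1 - s * x a ^ 2 + s ^ 2 / 2 * x a ^ 4) ∂μ :=
        lintegral_mono fun a => ENNReal.ofReal_le_ofReal (hp a)
    _ = ENNReal.ofReal (∫ a, (1 - s * x a ^ 2 + s ^ 2 / 2 * x a ^ 4) ∂μ) :=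
        (ofReal_integral_eq_lintegral_ofReal hint
          (ae_of_all _ fun a => (Real.exp_pos _).le.trans (hp a))).symm
    _ ≤ _ := by
        apply ENNReal.ofReal_le_ofReal
        have e : ∫ a, (1 - s * x a ^ 2 + s ^ 2 / 2 * x a ^ 4) ∂μ =
            ∫ _, (1 : ℝ) ∂μ - s * ∫ a, x a ^ 2 ∂μ + s ^ 2 / 2 * ∫ a, x a ^ 4 ∂μ := by
          rw [← integral_const_mul, ← integral_const_mul,
            ← integral_sub (integrable_const _) (hi2.const_mul _)]
          exact integral_add ((integrable_const _).sub (hi2.const_mul _)) (hi4.const_mul _)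
        rw [e, h1]
        simp only [integral_const, probReal_univ, smul_eq_mul, mul_one]
        have := Real.add_one_le_exp (-s + s ^ 2 * M / 2)
        have := mul_le_mul_of_nonneg_left h4' (show 0 ≤ s ^ 2 / 2 by positivity)
        linarith

theorem measure_sum_sq_lt_le {α : Type*} [MeasurableSpace α] {μ : Measure α}
    [IsProbabilityMeasure μ] {n : ℕ} {x : α → ℝ} (hx : Measurable x) (hx2 : MemLp x 2 μ)
    (h1 : ∫ a, x a ^ 2 ∂μ = 1) {M : ℝ} (hM : 0 < M)
    (h4 : ∫⁻ a, ENNReal.ofReal (x a ^ 4) ∂μ ≤ ENNReal.ofReal M) :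
    (Measure.pi fun _ : Fin n => μ) {ω | ∑ i, x (ω i) ^ 2 < 3 / 4 * n} ≤
      ENNReal.ofReal (Real.exp (-(n / (32 * M)))) := by
  -- Minimises `-s/4 + s²M/2`, the exponent per observation; the minimum is `-1/(32M)`.
  set s := (4 * M)⁻¹ with hs
  have hs0 : 0 ≤ s := by positivity
  set a := ENNReal.ofReal (Real.exp (-(s * (3 / 4 * n)))) with ha
  have hsub : {ω : Fin n → α | ∑ i, x (ω i) ^ 2 < 3 / 4 * n} ⊆
      {ω | a ≤ ENNReal.ofReal (Real.exp (∑ i, -(s * x (ω i) ^ 2)))} := by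
    intro ω hω
    refine ENNReal.ofReal_le_ofReal (Real.exp_le_exp.2 ?_)
    rw [Finset.sum_neg_distrib, ← Finset.mul_sum]
    exact neg_le_neg (mul_le_mul_of_nonneg_left (le_of_lt hω) hs0)
  have hint : ∫⁻ ω, ENNReal.ofReal (Real.exp (∑ i, -(s * x (ω i) ^ 2)))
      ∂(Measure.pi fun _ : Fin n => μ) ≤
      ENNReal.ofReal (Real.exp (n * (-s + s ^ 2 * M / 2))) := by
    simp_rw [ofReal_exp_sum]
    rw [lintegral_pi_prod (fun _ : Fin n => μ)
      (f := fun _ a => ENNReal.ofReal (Real.exp (-(s * x a ^ 2)))) (fun i => by fun_prop)]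
    refine (Finset.prod_le_prod' fun i _ =>
      lintegral_exp_neg_sq_le hx hx2 h1 hM.le h4 hs0).trans_eq ?_
    rw [← ofReal_exp_sum, Finset.sum_const, Finset.card_univ, Fintype.card_fin, nsmul_eq_mul]
  have ha0 : a ≠ 0 := by simp [ha, Real.exp_pos]
  calc _ ≤ _ := measure_mono hsub
    _ ≤ _ := meas_ge_le_lintegral_div (Measurable.aemeasurable (by fun_prop)) ha0 (by simp [ha])
    _ ≤ ENNReal.ofReal (Real.exp (n * (-s + s ^ 2 * M / 2))) / a := by gcongr
    _ = _ := by
        rw [ha, ← ENNReal.ofReal_div_of_pos (Real.exp_pos _), ← Real.exp_sub]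
        congr 2
        rw [hs]; field_simp; ring

/-- Lower deviation of `‖𝐙 v‖²` at a fixed vector `v`. -/
theorem measure_rows_mulVec_lt_le {α : Type*} [MeasurableSpace α] {μ : Measure α}
    [IsProbabilityMeasure μ] {n d : ℕ} {f : α → Fin d → ℝ} {g : ℝ} (hg : 0 < g)
    (h : LaplaceBound μ f (g • 1)) (hf : Measurable f) (hf2 : ∀ v, MemLp (fun a => f a ⬝ᵥ v) 2 μ)
    (h1 : ∀ v, ∫ a, (f a ⬝ᵥ v) ^ 2 ∂μ = v ⬝ᵥ v) (v : Fin d → ℝ) :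
    (Measure.pi fun _ : Fin n => μ) {ω | ((of fun i => f (ω i)) *ᵥ v) ⬝ᵥ
      ((of fun i => f (ω i)) *ᵥ v) < 3 / 4 * n * (v ⬝ᵥ v)} ≤
      ENNReal.ofReal (Real.exp (-(n / (32 * (64 * g ^ 2))))) := by
  by_cases hv : v = 0
  · simp [hv]
  have hv0 : 0 < v ⬝ᵥ v := lt_of_le_of_ne (dotProduct_self_nonneg' v)
    (fun e => hv (dotProduct_self_eq_zero.1 e.symm))
  set r := √(v ⬝ᵥ v) with hr
  have hr0 : 0 < r := Real.sqrt_pos.2 hv0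
  have hr2 : r ^ 2 = v ⬝ᵥ v := Real.sq_sqrt hv0.le
  set u := r⁻¹ • v with hu
  have huu : u ⬝ᵥ u = 1 := by
    rw [hu, smul_dotProduct, dotProduct_smul, smul_eq_mul, smul_eq_mul, ← hr2]; field_simp
  have hm : Measurable fun a => f a ⬝ᵥ u := by simp only [dotProduct]; fun_prop
  have h4 := lintegral_pow_four_le hg hm (fun t => by
    have := h.project u t
    simpa [smul_mulVec, huu] using this)
  have := measure_sum_sq_lt_le (n := n) hm (hf2 u) ((h1 u).trans huu) (by positivity) h4
  refine le_trans (measure_mono fun ω hω => ?_) this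
  simp only [Set.mem_ofPred_eq] at hω ⊢
  have e : ((of fun i => f (ω i)) *ᵥ v) ⬝ᵥ ((of fun i => f (ω i)) *ᵥ v) =
      r ^ 2 * ∑ i, (f (ω i) ⬝ᵥ u) ^ 2 := by
    rw [dotProduct, Finset.mul_sum]
    refine Finset.sum_congr rfl fun i _ => ?_
    rw [hu, dotProduct_smul, smul_eq_mul]
    change (f (ω i) ⬝ᵥ v) * (f (ω i) ⬝ᵥ v) = _
    field_simp
  rw [e, ← hr2] at hω
  have hr2' : 0 < r ^ 2 := by positivity
  nlinarith

/-- For a unit vector `x` and a net point `y`, `‖y‖ ≥ 1/2`, hence `‖Gx‖ ≥ ‖Gy‖ - ‖G(x - y)‖ ≥ b/2 -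
b/4`. A crude upper constant `B` is enough, since the mesh `e` can be made small accordingly. -/
theorem sq_mulVec_ge_of_net {m d : ℕ} (G : Matrix (Fin m) (Fin d) ℝ)
    {N : Finset (EuclideanSpace ℝ (Fin d))} {e B b : ℝ} (he : e ≤ 1 / 2) (hb : 0 ≤ b)
    (hN : ∀ x, ‖x‖ ≤ 1 → ∃ y ∈ N, ‖x - y‖ ≤ e)
    (hG : ∀ v, (G *ᵥ v) ⬝ᵥ (G *ᵥ v) ≤ B * (v ⬝ᵥ v)) (hB : B * e ^ 2 ≤ b ^ 2 / 16)
    (hlow : ∀ y ∈ N, b ^ 2 * (y.ofLp ⬝ᵥ y.ofLp) ≤ (G *ᵥ y.ofLp) ⬝ᵥ (G *ᵥ y.ofLp))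
    (v : Fin d → ℝ) : b ^ 2 / 16 * (v ⬝ᵥ v) ≤ (G *ᵥ v) ⬝ᵥ (G *ᵥ v) := by
  let T : EuclideanSpace ℝ (Fin d) →ₗ[ℝ] EuclideanSpace ℝ (Fin m) := Matrix.toEuclideanLin G
  have hTn : ∀ y, ‖T y‖ ^ 2 = (G *ᵥ y.ofLp) ⬝ᵥ (G *ᵥ y.ofLp) := fun y => norm_sq_eq_dotProduct _
  have hunit : ∀ x, ‖x‖ = 1 → b / 4 ≤ ‖T x‖ := by
    intro x hx
    obtain ⟨y, hy, hxy⟩ := hN x hx.le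
    have he0 : 0 ≤ e := (norm_nonneg _).trans hxy
    have hy1 : 1 / 2 ≤ ‖y‖ := by
      have := norm_sub_norm_le x y
      linarith
    have h1 : b / 2 ≤ ‖T y‖ := by
      have := hlow y hy
      rw [← hTn, ← norm_sq_eq_dotProduct, ← mul_pow] at this
      have := le_of_sq_le_sq this (norm_nonneg _)
      nlinarith
    have h2 : ‖T (x - y)‖ ≤ b / 4 := by
      have h3 := hG (x - y).ofLp
      rw [← hTn, ← norm_sq_eq_dotProduct] at h3
      apply le_of_sq_le_sq _ (by positivity)
      by_cases hB0 : 0 ≤ B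
      · calc _ ≤ _ := h3
          _ ≤ B * e ^ 2 := by gcongr
          _ ≤ _ := by linarith
      · nlinarith [sq_nonneg ‖x - y‖, sq_nonneg b]
    have h3 : T x = T y + T (x - y) := by rw [← map_add]; congr 1; abel
    have h4 := norm_sub_le (T x) (T (x - y))
    rw [h3, add_sub_cancel_right, ← h3] at h4
    linarith
  have hall : ∀ x, b / 4 * ‖x‖ ≤ ‖T x‖ := by
    intro x
    by_cases hx : x = 0
    · simp [hx]
    have hx0 : 0 < ‖x‖ := norm_pos_iff.2 hx
    have := hunit (‖x‖⁻¹ • x) (by rw [norm_smul, norm_inv, norm_norm]; field_simp)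
    rw [map_smul, norm_smul, norm_inv, norm_norm, ← div_eq_inv_mul, le_div_iff₀ hx0] at this
    exact this
  have h5 := pow_le_pow_left₀ (by positivity) (hall (WithLp.toLp 2 v)) 2
  rw [hTn, mul_pow, norm_toLp_sq] at h5
  linarith

/-- The operator norm is of order `√(gn)` with high probability, so a mesh depending on `g` alone
suffices. The net then has `5^{O(d)}` points, which the pointwise tail `e^{-n/(32M)}` beats once `d`
is a small fraction of `n`. -/
theorem exists_measure_rows_lower_le (g : ℝ) (hg : 0 < g) : ∃ C : ℝ, 0 < C ∧
    ∀ (n d : ℕ), 2 ≤ n → (d : ℝ) * Real.log n ≤ C * n →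
    ∀ {α : Type*} [MeasurableSpace α] (μ : Measure α) [IsProbabilityMeasure μ]
      (f : α → Fin d → ℝ), LaplaceBound μ f (g • 1) → Measurable f →
      (∀ v, MemLp (fun a => f a ⬝ᵥ v) 2 μ) → (∀ v, ∫ a, (f a ⬝ᵥ v) ^ 2 ∂μ = v ⬝ᵥ v) →
      (Measure.pi fun _ : Fin n => μ) {ω | ¬ ∀ v, 3 / 64 * n * (v ⬝ᵥ v) ≤
        ((of fun i => f (ω i)) *ᵥ v) ⬝ᵥ ((of fun i => f (ω i)) *ᵥ v)} ≤
      ENNReal.ofReal (2 / n) := by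
  -- Makes `B e² ≤ b²/16` for `B = 56gn`, `e = 2^{-(j+1)}` and `b² = 3n/4`.
  obtain ⟨j, hj⟩ := exists_pow_lt_of_lt_one (show 0 < 3 / (64 * (56 * g)) by positivity)
    (show (1 / 4 : ℝ) < 1 by norm_num)
  set M := 64 * g ^ 2 with hMdef
  have hM : 0 < M := by positivity
  refine ⟨min (1 / 2) (1 / (256 * (j + 1) * M)), by positivity, ?_⟩
  intro n d hn hd α _ μ _ f h hf hf2 h1
  set C := min (1 / 2) (1 / (256 * (j + 1) * M)) with hC
  have hC0 : 0 < C := by positivity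
  have hn0 : (0 : ℝ) < n := by positivity
  -- For `d = 0` the assumption says nothing about `n`; for `d ≥ 1` it also yields `log n ≤ Cn`,
  -- needed to reach probability `1/n`.
  by_cases hd0 : d = 0
  · subst hd0
    refine le_trans (le_of_eq ?_) zero_le
    convert measure_empty (μ := Measure.pi fun _ : Fin n => μ)
    refine Set.eq_empty_iff_forall_notMem.2 fun ω hω => hω fun v => ?_
    have : v = 0 := Subsingleton.elim _ _
    simp [this]
  have hd1 : (1 : ℝ) ≤ d := by exact_mod_cast Nat.one_le_iff_ne_zero.2 hd0
  -- Turns `d log n ≤ Cn` into `d ≤ 2Cn`.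
  have hlog2 : 1 / 2 ≤ Real.log n := by
    have h2 : Real.log 2 ≤ Real.log n := Real.log_le_log (by norm_num) (by exact_mod_cast hn)
    have := Real.log_two_gt_d9
    linarith
  have hC1 : C ≤ 1 / 2 := min_le_left _ _
  have hC2 : C * (256 * (j + 1) * M) ≤ 1 := by
    have := min_le_right (1 / 2) (1 / (256 * ((j : ℝ) + 1) * M))
    rwa [le_div_iff₀ (by positivity)] at this
  have hdC : (d : ℝ) ≤ 2 * C * n := by nlinarith
  have hdn : (d : ℝ) ≤ n := by nlinarith
  have hlogn : Real.log n ≤ C * n := by nlinarith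
  obtain ⟨N, hNc, hN⟩ := exists_dyadic_net d (j + 1)
  set b := √(3 / 4 * n) with hb
  have hb2 : b ^ 2 = 3 / 4 * n := Real.sq_sqrt (by positivity)
  have hup := h.measure_rows_opNorm_le (n := n) hf (PosSemidef.one.smul hg.le) hg.le
    (fun v => by simp [smul_mulVec])
  have hsub : {ω : Fin n → α | ¬ ∀ v, 3 / 64 * n * (v ⬝ᵥ v) ≤
        ((of fun i => f (ω i)) *ᵥ v) ⬝ᵥ ((of fun i => f (ω i)) *ᵥ v)} ⊆
      {ω | ¬ ∀ v, ((of fun i => f (ω i)) *ᵥ v) ⬝ᵥ ((of fun i => f (ω i)) *ᵥ v) ≤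
        (8 * (g • (1 : Matrix (Fin d) (Fin d) ℝ)).trace + 48 * n * g) * (v ⬝ᵥ v)} ∪
      ⋃ y ∈ N, {ω | ((of fun i => f (ω i)) *ᵥ y.ofLp) ⬝ᵥ ((of fun i => f (ω i)) *ᵥ y.ofLp) <
        3 / 4 * n * (y.ofLp ⬝ᵥ y.ofLp)} := by
    intro ω hω
    by_contra hcon
    simp only [Set.mem_union, Set.mem_iUnion, Set.mem_ofPred_eq, exists_prop, not_or, not_not,
      not_exists, not_and, not_lt] at hcon
    refine hω fun v => ?_
    have := sq_mulVec_ge_of_net (b := b) (B := 56 * g * n) (e := (1 / 2) ^ (j + 1))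
      (of fun i => f (ω i))
      (by rw [pow_succ]; have := pow_le_one₀ (n := j) (show (0 : ℝ) ≤ 1 / 2 by norm_num)
            (by norm_num); linarith)
      (Real.sqrt_nonneg _) hN (fun v => (hcon.1 v).trans (by
        apply mul_le_mul_of_nonneg_right _ (dotProduct_self_nonneg' v)
        simp only [trace_smul, trace_one, Fintype.card_fin, smul_eq_mul]
        nlinarith)) ?_ (fun y hy => by rw [hb2]; exact hcon.2 y hy) v
    · rw [hb2] at this
      linarith
    · rw [hb2, ← pow_mul, mul_comm (j + 1) 2, pow_mul]
      norm_num
      have h5 : (1 / 4 : ℝ) ^ (j + 1) ≤ (1 / 4) ^ j := by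
        rw [pow_succ]; have : (0 : ℝ) ≤ (1 / 4) ^ j := by positivity
        linarith
      have h6 := h5.trans hj.le
      rw [le_div_iff₀ (by positivity)] at h6
      nlinarith
  refine (measure_mono hsub).trans ((measure_union_le _ _).trans ?_)
  have hA : (Measure.pi fun _ : Fin n => μ) {ω | ¬ ∀ v, ((of fun i => f (ω i)) *ᵥ v) ⬝ᵥ
      ((of fun i => f (ω i)) *ᵥ v) ≤
        (8 * (g • (1 : Matrix (Fin d) (Fin d) ℝ)).trace + 48 * n * g) * (v ⬝ᵥ v)} ≤
      ENNReal.ofReal (1 / n) := by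
    refine hup.trans (ENNReal.ofReal_le_ofReal ?_)
    rw [Real.exp_neg, one_div]
    exact inv_anti₀ hn0 (by linarith [Real.add_one_le_exp (n : ℝ)])
  have hBd : (Measure.pi fun _ : Fin n => μ) (⋃ y ∈ N, {ω | ((of fun i => f (ω i)) *ᵥ y.ofLp) ⬝ᵥ
      ((of fun i => f (ω i)) *ᵥ y.ofLp) < 3 / 4 * n * (y.ofLp ⬝ᵥ y.ofLp)}) ≤
      ENNReal.ofReal (1 / n) := by
    refine (measure_biUnion_finset_le _ _).trans ?_
    refine (Finset.sum_le_sum fun y _ =>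
      measure_rows_mulVec_lt_le hg h hf hf2 h1 y.ofLp).trans ?_
    rw [Finset.sum_const, nsmul_eq_mul, ← ENNReal.ofReal_natCast,
      ← ENNReal.ofReal_mul (by positivity)]
    apply ENNReal.ofReal_le_ofReal
    have h5 : (5 : ℝ) ≤ Real.exp 2 := by
      have := Real.quadratic_le_exp_of_nonneg (x := 2) (by norm_num)
      linarith
    have h6 : (N.card : ℝ) ≤ Real.exp (2 * ((j + 1) * d)) := by
      calc (N.card : ℝ) ≤ 5 ^ ((j + 1) * d) := by exact_mod_cast hNc
        _ ≤ (Real.exp 2) ^ ((j + 1) * d) := by gcongr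
        _ = _ := by rw [← Real.exp_nat_mul]; push_cast; ring_nf
    calc (N.card : ℝ) * Real.exp (-(n / (32 * M)))
        ≤ Real.exp (2 * ((j + 1) * d)) * Real.exp (-(n / (32 * M))) := by gcongr
      _ = Real.exp (2 * ((j + 1) * d) - n / (32 * M)) := by rw [← Real.exp_add]; ring_nf
      _ ≤ Real.exp (-Real.log n) := by
          apply Real.exp_le_exp.2
          have hq : (0 : ℝ) < n / (64 * M) := by positivity
          have e1 : (n : ℝ) / (32 * M) = 2 * (n / (64 * M)) := by field_simp; ring
          have e2 : 2 * (((j : ℝ) + 1) * d) ≤ n / (64 * M) := by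
            rw [le_div_iff₀ (by positivity)]
            calc 2 * (((j : ℝ) + 1) * d) * (64 * M) ≤ 2 * (((j : ℝ) + 1) * (2 * C * n)) * (64 * M) := by
                  gcongr
              _ = C * (256 * (j + 1) * M) * n := by ring
              _ ≤ 1 * n := by gcongr
              _ = n := one_mul _
          have e3 : Real.log n ≤ n / (64 * M) := by
            rw [le_div_iff₀ (by positivity)]
            have : C * (64 * M) ≤ 1 := by
              refine le_trans ?_ hC2
              have : (0 : ℝ) ≤ j := by positivity
              gcongr
              nlinarith
            calc Real.log n * (64 * M) ≤ C * n * (64 * M) := by gcongr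
              _ = C * (64 * M) * n := by ring
              _ ≤ 1 * n := by gcongr
              _ = n := one_mul _
          linarith
      _ = 1 / n := by rw [Real.exp_neg, Real.exp_log hn0, one_div]
  refine (add_le_add hA hBd).trans_eq ?_
  rw [← ENNReal.ofReal_add (by positivity) (by positivity)]
  congr 1; ring

/-! ### Operator norms and traces -/

theorem dotProduct_mulVec_le_opNorm {p : ℕ} (M : Matrix (Fin p) (Fin p) ℝ) (v : Fin p → ℝ) :
    v ⬝ᵥ M *ᵥ v ≤ opNorm M * (v ⬝ᵥ v) := by
  let T := Matrix.toEuclideanCLM (n := Fin p) (𝕜 := ℝ) M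
  have h1 : v ⬝ᵥ M *ᵥ v = inner ℝ (WithLp.toLp 2 v) (T (WithLp.toLp 2 v)) := by
    rw [PiLp.inner_apply, dotProduct]
    exact Finset.sum_congr rfl fun i _ => mul_comm _ _
  rw [h1, ← norm_toLp_sq]
  calc _ ≤ ‖WithLp.toLp 2 v‖ * ‖T (WithLp.toLp 2 v)‖ := real_inner_le_norm _ _
    _ ≤ ‖WithLp.toLp 2 v‖ * (‖T‖ * ‖WithLp.toLp 2 v‖) := by gcongr; exact T.le_opNorm _
    _ = _ := by rw [opNorm]; ring

theorem opNorm_nonneg {p : ℕ} (M : Matrix (Fin p) (Fin p) ℝ) : 0 ≤ opNorm M := norm_nonneg _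

/-- The noise events are stated with `opNorm (G * Gᵀ)`, which is measurable in the data; this
converts deterministic bounds on `‖Gv‖²` into bounds on it. -/
theorem opNorm_mul_transpose_le {m : ℕ} (G : Matrix (Fin m) (Fin m) ℝ) {b : ℝ} (hb : 0 ≤ b)
    (hG : ∀ v, (G *ᵥ v) ⬝ᵥ (G *ᵥ v) ≤ b * (v ⬝ᵥ v)) : opNorm (G * Gᵀ) ≤ b := by
  refine ContinuousLinearMap.opNorm_le_bound _ hb fun x => ?_
  apply le_of_sq_le_sq _ (by positivity)
  have hGt := sq_mulVec_le_of_transpose Gᵀ hb (by simpa using hG)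
  rw [mul_pow, norm_sq_eq_dotProduct, norm_sq_eq_dotProduct]
  change ((G * Gᵀ) *ᵥ x.ofLp) ⬝ᵥ ((G * Gᵀ) *ᵥ x.ofLp) ≤ _
  rw [← mulVec_mulVec]
  calc _ ≤ _ := hG _
    _ ≤ b * (b * (x.ofLp ⬝ᵥ x.ofLp)) := by gcongr; exact hGt _
    _ = _ := by ring

theorem measurable_opNorm_mul_transpose {α : Type*} [MeasurableSpace α] {m : ℕ}
    {G : α → Matrix (Fin m) (Fin m) ℝ} (hG : ∀ i j, Measurable fun a => G a i j) :
    Measurable fun a => opNorm (G a * (G a)ᵀ) := by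
  have hc : Continuous fun M : Matrix (Fin m) (Fin m) ℝ => opNorm M := by
    refine continuous_norm.comp ?_
    exact LinearMap.continuous_of_finiteDimensional
      (Matrix.toEuclideanCLM (n := Fin m) (𝕜 := ℝ)).toAlgEquiv.toLinearMap
  have hc' : Continuous fun M : Fin m → Fin m → ℝ => opNorm (of M) := hc
  refine hc'.measurable.comp (f := fun a i j => (G a * (G a)ᵀ) i j) ?_
  refine measurable_pi_lambda _ fun i => measurable_pi_lambda _ fun j => ?_
  simp only [mul_apply, transpose_apply]
  exact Finset.measurable_sum _ fun l _ => (hG i l).mul (hG j l)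

/-- The trace is a sum of `rank S` nonzero eigenvalues, each at most `L`. This is how `k` and `min K
k`, rather than `n`, come to measure the noise. -/
theorem trace_le_rank_mul {d : ℕ} {S : Matrix (Fin d) (Fin d) ℝ} (hS : S.PosSemidef) {L : ℝ}
    (hL0 : 0 ≤ L) (hL : ∀ v, v ⬝ᵥ S *ᵥ v ≤ L * (v ⬝ᵥ v)) {r : ℕ} (hr : S.rank ≤ r) :
    S.trace ≤ r * L := by
  obtain ⟨Q, l, -, h2, hSe, hl0, htr, hrank⟩ := exists_orthogonal_diagonal hS
  have hlL : ∀ j, l j ≤ L := by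
    intro j
    have := hL (Q *ᵥ Pi.single j 1)
    rw [dotProduct_mulVec_orthogonal_diagonal h2 hSe, dotProduct_orthogonal_mulVec h2] at this
    simpa [Pi.single_apply, Finset.sum_ite_eq'] using this
  rw [htr, ← Finset.sum_filter_ne_zero]
  calc ∑ j with l j ≠ 0, l j ≤ ∑ j with l j ≠ 0, L := Finset.sum_le_sum fun j _ => hlL j
    _ = (S.rank : ℝ) * L := by rw [Finset.sum_const, nsmul_eq_mul, hrank, Fintype.card_subtype]
    _ ≤ _ := by gcongr

/-! ### Principal component regression as a spectral cut-off -/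

/-- `pinv` is picked by choice, so it is computed by exhibiting an inverse and invoking uniqueness.
-/
theorem IsMoorePenrose.unique {m n : Type*} [Fintype m] [Fintype n] {M : Matrix m n ℝ}
    {N N' : Matrix n m ℝ} (h : IsMoorePenrose M N) (h' : IsMoorePenrose M N') : N = N' := by
  have h1 : M * N = M * N' := by
    calc M * N = (M * N)ᵀ := h.symm_left.symm
      _ = (M * N' * M * N)ᵀ := by rw [h'.mul_mul_self]
      _ = (M * N)ᵀ * (M * N')ᵀ := by rw [← transpose_mul]; simp only [Matrix.mul_assoc]
      _ = M * N * M * N' := by rw [h.symm_left, h'.symm_left]; simp only [Matrix.mul_assoc]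
      _ = M * N' := by rw [h.mul_mul_self]
  have h2 : N * M = N' * M := by
    calc N * M = (N * M)ᵀ := h.symm_right.symm
      _ = (N * (M * N' * M))ᵀ := by rw [h'.mul_mul_self]
      _ = (N' * M)ᵀ * (N * M)ᵀ := by rw [← transpose_mul]; simp only [Matrix.mul_assoc]
      _ = N' * (M * N * M) := by rw [h.symm_right, h'.symm_right]; simp only [Matrix.mul_assoc]
      _ = N' * M := by rw [h.mul_mul_self]
  calc N = N * M * N := h.mul_mul_inv.symm
    _ = N' * (M * N) := by rw [h2, Matrix.mul_assoc]
    _ = N' := by rw [h1, ← Matrix.mul_assoc, h'.mul_mul_inv]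

theorem pinv_diagonal {m : Type*} [Fintype m] [DecidableEq m] (d : m → ℝ) :
    pinv (diagonal d) = diagonal fun i => (d i)⁻¹ := by
  refine (Classical.choose_spec (exists_isMoorePenrose (diagonal d))).unique ⟨?_, ?_, ?_, ?_⟩
  · simp [diagonal_mul_diagonal]
  · simp only [diagonal_mul_diagonal]
    congr 1; ext i
    by_cases h : d i = 0 <;> simp [h]
  · simp [diagonal_mul_diagonal]
  · simp [diagonal_mul_diagonal]

/-- The spectral cut-off `∑_{j ≤ k} σ_j⁻² u_j u_jᵀ 𝐗ᵀ` of the pseudo-inverse of `𝐗`. -/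
noncomputable def pcInv {n p : ℕ} (X : Matrix (Fin n) (Fin p) ℝ) (U : Matrix (Fin p) (Fin p) ℝ)
    (k : ℕ) : Matrix (Fin p) (Fin n) ℝ :=
  U * diagonal (fun j : Fin p => if (j : ℕ) < k then (singularValue X (j + 1) ^ 2)⁻¹ else 0) *
    Uᵀ * Xᵀ

/-- The orthogonal projection onto the span of the first `k` columns of `U`. -/
noncomputable def pcProj {p : ℕ} (U : Matrix (Fin p) (Fin p) ℝ) (k : ℕ) :
    Matrix (Fin p) (Fin p) ℝ :=
  U * diagonal (fun j : Fin p => if (j : ℕ) < k then 1 else 0) * Uᵀ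

theorem singularValue_sq_antitone {n p : ℕ} (X : Matrix (Fin n) (Fin p) ℝ) {i j : ℕ}
    (h : i ≤ j) : singularValue X (j + 1) ^ 2 ≤ singularValue X (i + 1) ^ 2 :=
  pow_le_pow_left₀ (LinearMap.singularValues_nonneg _ _)
    (LinearMap.singularValues_antitone _ (by omega)) 2

theorem singularValue_pos_iff {n p : ℕ} (X : Matrix (Fin n) (Fin p) ℝ) (j : ℕ) :
    0 < singularValue X (j + 1) ↔ j < X.rank := by
  rw [singularValue, LinearMap.singularValues_pos_iff_lt_finrank_range, Nat.add_sub_cancel,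
    Matrix.rank_eq_finrank_range_toLin X (EuclideanSpace.basisFun (Fin n) ℝ).toBasis
      (EuclideanSpace.basisFun (Fin p) ℝ).toBasis, Matrix.toEuclideanLin_eq_toLin_orthonormal]

section

variable {n p : ℕ} {X : Matrix (Fin n) (Fin p) ℝ} {U : Matrix (Fin p) (Fin p) ℝ}

theorem IsRightSingularBasis.orthogonal' (hU : IsRightSingularBasis X U) : U * Uᵀ = 1 :=
  mul_eq_one_comm.1 hU.orthogonal

theorem IsRightSingularBasis.gram_mul (hU : IsRightSingularBasis X U) :
    Xᵀ * X * U = U * diagonal fun j : Fin p => singularValue X (j + 1) ^ 2 := by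
  ext i j
  have := congrFun (hU.eigen j) i
  rw [mul_diagonal, mul_comm]
  exact this

theorem IsRightSingularBasis.conj_gram (hU : IsRightSingularBasis X U) :
    Uᵀ * Xᵀ * X * U = diagonal fun j : Fin p => singularValue X (j + 1) ^ 2 := by
  rw [Matrix.mul_assoc Uᵀ, Matrix.mul_assoc, hU.gram_mul, ← Matrix.mul_assoc, hU.orthogonal,
    Matrix.one_mul]

/-- In the singular basis the compressed Gram matrix is diagonal, so its pseudo-inverse is taken
entrywise. The right-hand side no longer involves a type depending on `k`. -/
theorem IsRightSingularBasis.coef_eq (hU : IsRightSingularBasis X U) (Y : Fin n → ℝ) (k : ℕ) :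
    coef X Y (firstCols U k) = pcInv X U k *ᵥ Y := by
  have h1 : (firstCols U k)ᵀ * Xᵀ * X * firstCols U k =
      diagonal fun j : {j : Fin p // (j : ℕ) < k} => singularValue X (j.1 + 1) ^ 2 := by
    ext a b
    have := congrFun (congrFun hU.conj_gram a.1) b.1
    simp only [Matrix.mul_apply, firstCols, submatrix_apply, transpose_apply, id, diagonal_apply,
      Subtype.ext_iff] at this ⊢
    exact this
  rw [coef, h1, pinv_diagonal, pcInv]
  have h2 : firstCols U k *
      (diagonal fun j : {j : Fin p // (j : ℕ) < k} => (singularValue X (j.1 + 1) ^ 2)⁻¹) *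
      (firstCols U k)ᵀ = U * diagonal (fun j : Fin p => if (j : ℕ) < k then
        (singularValue X (j + 1) ^ 2)⁻¹ else 0) * Uᵀ := by
    ext a b
    rw [Matrix.mul_apply, Matrix.mul_apply]
    simp only [mul_diagonal, firstCols, transpose_apply, submatrix_apply, id, mul_ite, ite_mul,
      mul_zero, zero_mul]
    rw [← Finset.sum_filter]
    exact (Finset.sum_subtype _ (by simp)
      fun j : Fin p => U a j * (singularValue X (j + 1) ^ 2)⁻¹ * U b j).symm
  rw [h2]

theorem IsRightSingularBasis.sq_mulVec (hU : IsRightSingularBasis X U) (w : Fin p → ℝ) :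
    (X *ᵥ (U *ᵥ w)) ⬝ᵥ (X *ᵥ (U *ᵥ w)) = ∑ j : Fin p, singularValue X (j + 1) ^ 2 * w j ^ 2 := by
  rw [mulVec_mulVec, dotProduct_mulVec, vecMul_mulVec, transpose_mul, ← Matrix.mul_assoc,
    hU.conj_gram, dotProduct]
  refine Finset.sum_congr rfl fun j _ => ?_
  rw [vecMul_diagonal]; ring

/-- The bound on `k` makes the retained singular values nonzero, so they cancel. -/
theorem pcInv_mul (hU : IsRightSingularBasis X U) {k : ℕ} (hk : k ≤ X.rank) :
    pcInv X U k * X = pcProj U k := by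
  have h1 : Uᵀ * Xᵀ * X = (diagonal fun j : Fin p => singularValue X (j + 1) ^ 2) * Uᵀ := by
    rw [← hU.conj_gram, Matrix.mul_assoc _ U, hU.orthogonal', Matrix.mul_one]
  rw [pcInv, Matrix.mul_assoc, Matrix.mul_assoc, ← Matrix.mul_assoc Uᵀ, h1, ← Matrix.mul_assoc,
    Matrix.mul_assoc U, diagonal_mul_diagonal, pcProj]
  congr 3
  ext j
  split_ifs with h
  · exact inv_mul_cancel₀ (pow_pos ((singularValue_pos_iff X j).2 (h.trans_le hk)) 2).ne'
  · simp

theorem pcProj_mul_pcInv (hU : IsRightSingularBasis X U) (k : ℕ) :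
    pcProj U k * pcInv X U k = pcInv X U k := by
  rw [pcInv, pcProj, ← Matrix.mul_assoc, ← Matrix.mul_assoc, ← Matrix.mul_assoc,
    Matrix.mul_assoc _ Uᵀ U, hU.orthogonal, Matrix.mul_one, Matrix.mul_assoc U,
    diagonal_mul_diagonal]
  congr 4
  ext j
  split_ifs <;> simp

theorem sq_mulVec_le_of_idempotent {m : ℕ} {Q : Matrix (Fin m) (Fin m) ℝ} (h1 : Qᵀ = Q)
    (h2 : Q * Q = Q) (v : Fin m → ℝ) : (Q *ᵥ v) ⬝ᵥ (Q *ᵥ v) ≤ v ⬝ᵥ v := by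
  have e : (Q *ᵥ v) ⬝ᵥ (Q *ᵥ v) = (Q *ᵥ v) ⬝ᵥ v := by
    rw [dotProduct_mulVec, vecMul_mulVec, h1, h2, ← mulVec_transpose, h1]
  have := dotProduct_self_nonneg' (v - Q *ᵥ v)
  rw [sub_dotProduct, dotProduct_sub, dotProduct_sub, e, dotProduct_comm v (Q *ᵥ v)] at this
  rw [e]; linarith

theorem sq_pcProj_mulVec_le (hU : IsRightSingularBasis X U) (k : ℕ) (v : Fin p → ℝ) :
    (pcProj U k *ᵥ v) ⬝ᵥ (pcProj U k *ᵥ v) ≤ v ⬝ᵥ v := by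
  refine sq_mulVec_le_of_idempotent ?_ ?_ v
  · simp [pcProj, Matrix.mul_assoc]
  · rw [pcProj, ← Matrix.mul_assoc, ← Matrix.mul_assoc,
      Matrix.mul_assoc _ Uᵀ U, hU.orthogonal, Matrix.mul_one, Matrix.mul_assoc U,
      diagonal_mul_diagonal]
    congr 3
    ext j
    split_ifs <;> simp

theorem sq_mul_pcInv_mulVec_le (hU : IsRightSingularBasis X U) {k : ℕ} (hk : k ≤ X.rank)
    (v : Fin n → ℝ) : ((X * pcInv X U k) *ᵥ v) ⬝ᵥ ((X * pcInv X U k) *ᵥ v) ≤ v ⬝ᵥ v := by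
  refine sq_mulVec_le_of_idempotent ?_ ?_ v
  · simp [pcInv, Matrix.mul_assoc]
  · rw [Matrix.mul_assoc, ← Matrix.mul_assoc _ X, pcInv_mul hU hk, pcProj_mul_pcInv hU]

/-- The image of `pcInv` lies in the span of the first `k` singular directions, where `‖u‖² ≤
c‖𝐗u‖²`. -/
theorem sq_pcInv_mulVec_le (hU : IsRightSingularBasis X U) {k : ℕ} {c : ℝ}
    (hc : ∀ j < k, 1 ≤ c * singularValue X (j + 1) ^ 2) (v : Fin n → ℝ) :
    (pcInv X U k *ᵥ v) ⬝ᵥ (pcInv X U k *ᵥ v) ≤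
      c * (((X * pcInv X U k) *ᵥ v) ⬝ᵥ ((X * pcInv X U k) *ᵥ v)) := by
  set w := diagonal (fun j : Fin p => if (j : ℕ) < k then (singularValue X (j + 1) ^ 2)⁻¹ else 0)
    *ᵥ ((Uᵀ * Xᵀ) *ᵥ v) with hw
  have h1 : pcInv X U k *ᵥ v = U *ᵥ w := by
    rw [hw, mulVec_mulVec, mulVec_mulVec, pcInv]; simp only [Matrix.mul_assoc]
  rw [← mulVec_mulVec, h1, dotProduct_orthogonal_mulVec hU.orthogonal, hU.sq_mulVec,
    Finset.mul_sum, dotProduct]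
  refine Finset.sum_le_sum fun j _ => ?_
  by_cases hj : (j : ℕ) < k
  · have := mul_le_mul_of_nonneg_right (hc j hj) (sq_nonneg (w j))
    linarith
  · have : w j = 0 := by rw [hw, mulVec_diagonal, if_neg hj, zero_mul]
    simp [this]

/-- Only discarded directions survive; in the 1-based numbering the first of them carries `σ_{k+1}`.
-/
theorem sq_mulVec_sub_pcProj_le (hU : IsRightSingularBasis X U) (k : ℕ) (v : Fin p → ℝ) :
    (X *ᵥ (v - pcProj U k *ᵥ v)) ⬝ᵥ (X *ᵥ (v - pcProj U k *ᵥ v)) ≤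
      singularValue X (k + 1) ^ 2 * (v ⬝ᵥ v) := by
  set y := Uᵀ *ᵥ v with hy
  have hv : v = U *ᵥ y := by rw [hy, mulVec_mulVec, hU.orthogonal', one_mulVec]
  set w := y - diagonal (fun j : Fin p => if (j : ℕ) < k then (1 : ℝ) else 0) *ᵥ y with hw
  have h1 : v - pcProj U k *ᵥ v = U *ᵥ w := by
    rw [hw, mulVec_sub, ← hv, pcProj, hy]
    simp only [mulVec_mulVec, Matrix.mul_assoc]
  have h2 : v ⬝ᵥ v = y ⬝ᵥ y := by
    rw [hv, dotProduct_orthogonal_mulVec hU.orthogonal]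
  rw [h1, h2, hU.sq_mulVec, dotProduct, Finset.mul_sum]
  refine Finset.sum_le_sum fun j _ => ?_
  by_cases hj : (j : ℕ) < k
  · have : w j = 0 := by rw [hw, Pi.sub_apply, mulVec_diagonal, if_pos hj, one_mul, sub_self]
    rw [this]
    have := mul_self_nonneg (y j)
    have := sq_nonneg (singularValue X (k + 1))
    simp; positivity
  · have : w j = y j := by rw [hw, Pi.sub_apply, mulVec_diagonal, if_neg hj, zero_mul, sub_zero]
    rw [this, ← sq]
    exact mul_le_mul_of_nonneg_right (singularValue_sq_antitone X (by omega)) (sq_nonneg _)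

theorem rank_pcInv_le (X : Matrix (Fin n) (Fin p) ℝ) (U : Matrix (Fin p) (Fin p) ℝ) (k : ℕ) :
    (pcInv X U k).rank ≤ k := by
  rw [pcInv]
  refine (rank_mul_le_left _ _).trans ((rank_mul_le_left _ _).trans
    ((rank_mul_le_right _ _).trans ?_))
  rw [rank_diagonal, Fintype.card_subtype]
  calc _ ≤ (Finset.univ.filter fun j : Fin p => (j : ℕ) < k).card := by
        refine Finset.card_le_card fun j hj => ?_
        simp only [Finset.mem_filter, Finset.mem_univ, true_and] at hj ⊢
        by_contra h
        simp [h] at hj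
    _ ≤ (Finset.range k).card := Finset.card_le_card_of_injOn (fun j => (j : ℕ))
        (fun j hj => by simpa using hj) (fun a _ b _ h => Fin.ext h)
    _ = k := Finset.card_range k

end

/-! ### The deterministic part of the risk bound -/

theorem sq_add_le {ι : Type*} [Fintype ι] (a b : ι → ℝ) :
    (a + b) ⬝ᵥ (a + b) ≤ 2 * (a ⬝ᵥ a) + 2 * (b ⬝ᵥ b) := by
  have := dotProduct_self_nonneg' (a - b)
  rw [sub_dotProduct, dotProduct_sub, dotProduct_sub] at this
  rw [add_dotProduct, dotProduct_add, dotProduct_add]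
  linarith

theorem sq_sub_le {ι : Type*} [Fintype ι] (a b : ι → ℝ) :
    (a - b) ⬝ᵥ (a - b) ≤ 2 * (a ⬝ᵥ a) + 2 * (b ⬝ᵥ b) := by
  have := sq_add_le a (-b)
  rwa [← sub_eq_add_neg, neg_dotProduct_neg] at this

section

variable {n p K : ℕ} {X W : Matrix (Fin n) (Fin p) ℝ} {Z : Matrix (Fin n) (Fin K) ℝ}
  {A : Matrix (Fin p) (Fin K) ℝ} {U : Matrix (Fin p) (Fin p) ℝ}
  {a : Fin p → ℝ} {k : ℕ} {q δ w : ℝ}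

/-- `𝐙AᵀR = 𝐗R - 𝐖R`: the first summand is a contraction, and `‖𝐖Rx‖² ≤ nδ‖Rx‖² ≤ δq‖x‖²`.
Throughout, `q` plays the role of `1/λ̂_k` and `δ` that of `δ_W`. -/
theorem sq_factor_pcInv_le (hU : IsRightSingularBasis X U) (hX : X = Z * Aᵀ + W)
    (hn : 0 < n) (hk : k ≤ X.rank) (hq0 : 0 ≤ q) (hδ : 0 ≤ δ)
    (hq : ∀ j < k, 1 ≤ q / n * singularValue X (j + 1) ^ 2)
    (hW : ∀ v, (W *ᵥ v) ⬝ᵥ (W *ᵥ v) ≤ n * δ * (v ⬝ᵥ v)) (x : Fin n → ℝ) :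
    ((Z * Aᵀ * pcInv X U k) *ᵥ x) ⬝ᵥ ((Z * Aᵀ * pcInv X U k) *ᵥ x) ≤
      (2 + 2 * (δ * q)) * (x ⬝ᵥ x) := by
  have hn' : (0 : ℝ) < n := by exact_mod_cast hn
  have e : (Z * Aᵀ * pcInv X U k) *ᵥ x =
      (X * pcInv X U k) *ᵥ x - W *ᵥ (pcInv X U k *ᵥ x) := by
    rw [show Z * Aᵀ = X - W by rw [hX, add_sub_cancel_right], Matrix.sub_mul, sub_mulVec,
      mulVec_mulVec]
  have h1 := sq_mul_pcInv_mulVec_le hU hk x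
  have h2 := sq_pcInv_mulVec_le hU hq x
  have h3 := hW (pcInv X U k *ᵥ x)
  rw [e]
  refine (sq_sub_le _ _).trans ?_
  have h4 : n * δ * ((pcInv X U k *ᵥ x) ⬝ᵥ (pcInv X U k *ᵥ x)) ≤ n * δ * (q / n * (x ⬝ᵥ x)) := by
    gcongr
    exact h2.trans (by gcongr)
  have h5 : n * δ * (q / n * (x ⬝ᵥ x)) = δ * q * (x ⬝ᵥ x) := by field_simp
  linarith

theorem pcInv_mulVec_factor (hU : IsRightSingularBasis X U) (hX : X = Z * Aᵀ + W)
    (hk : k ≤ X.rank) :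
    pcInv X U k *ᵥ (Z *ᵥ (Aᵀ *ᵥ a)) = pcProj U k *ᵥ a - pcInv X U k *ᵥ (W *ᵥ a) := by
  rw [mulVec_mulVec a Z, show Z * Aᵀ = X - W by rw [hX, add_sub_cancel_right], sub_mulVec,
    mulVec_sub, mulVec_mulVec, pcInv_mul hU hk]

theorem sq_coef_le (hU : IsRightSingularBasis X U) (hX : X = Z * Aᵀ + W)
    (hn : 0 < n) (hk : k ≤ X.rank) (hq0 : 0 ≤ q)
    (hq : ∀ j < k, 1 ≤ q / n * singularValue X (j + 1) ^ 2)
    (hWa : (W *ᵥ a) ⬝ᵥ (W *ᵥ a) ≤ n * w * (a ⬝ᵥ a)) (e : Fin n → ℝ) :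
    (pcInv X U k *ᵥ (Z *ᵥ (Aᵀ *ᵥ a) + e)) ⬝ᵥ (pcInv X U k *ᵥ (Z *ᵥ (Aᵀ *ᵥ a) + e)) ≤
      4 * (1 + q * w) * (a ⬝ᵥ a) +
        2 * (q / n * (((X * pcInv X U k) *ᵥ e) ⬝ᵥ ((X * pcInv X U k) *ᵥ e))) := by
  have hn' : (0 : ℝ) < n := by exact_mod_cast hn
  have e1 := pcInv_mulVec_factor (a := a) hU hX hk
  have h1 := sq_pcProj_mulVec_le hU k a
  have h2 := (sq_pcInv_mulVec_le hU hq (W *ᵥ a)).trans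
    (mul_le_mul_of_nonneg_left ((sq_mul_pcInv_mulVec_le hU hk _).trans hWa)
      (show 0 ≤ q / n by positivity))
  have h3 := sq_pcInv_mulVec_le hU hq e
  have h4 := sq_sub_le (pcProj U k *ᵥ a) (pcInv X U k *ᵥ (W *ᵥ a))
  have h5 : q / n * (n * w * (a ⬝ᵥ a)) = q * w * (a ⬝ᵥ a) := by field_simp
  rw [mulVec_add, e1]
  refine (sq_add_le _ _).trans ?_
  linarith

/-- The in-sample residual splits into `𝐗a'`, `𝐖a'`, `𝐙AᵀR𝐖a` and `𝐙AᵀRe` with `a' = a - Πa`; two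
rounds of `‖x ± y‖² ≤ 2‖x‖² + 2‖y‖²` give the factor `4`. -/
theorem sq_residual_le (hU : IsRightSingularBasis X U) (hX : X = Z * Aᵀ + W)
    (hn : 0 < n) (hk : k ≤ X.rank) (hq0 : 0 ≤ q) (hδ : 0 ≤ δ)
    (hq : ∀ j < k, 1 ≤ q / n * singularValue X (j + 1) ^ 2)
    (hW : ∀ v, (W *ᵥ v) ⬝ᵥ (W *ᵥ v) ≤ n * δ * (v ⬝ᵥ v))
    (hWa : (W *ᵥ a) ⬝ᵥ (W *ᵥ a) ≤ n * w * (a ⬝ᵥ a)) (e : Fin n → ℝ) :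
    (Z *ᵥ (Aᵀ *ᵥ a - Aᵀ *ᵥ (pcInv X U k *ᵥ (Z *ᵥ (Aᵀ *ᵥ a) + e)))) ⬝ᵥ
      (Z *ᵥ (Aᵀ *ᵥ a - Aᵀ *ᵥ (pcInv X U k *ᵥ (Z *ᵥ (Aᵀ *ᵥ a) + e)))) ≤
      4 * (singularValue X (k + 1) ^ 2 + 4 * (n * δ) + (2 + 2 * (δ * q)) * (n * w)) * (a ⬝ᵥ a) +
        4 * (((Z * Aᵀ * pcInv X U k) *ᵥ e) ⬝ᵥ ((Z * Aᵀ * pcInv X U k) *ᵥ e)) := by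
  have hn' : (0 : ℝ) < n := by exact_mod_cast hn
  have hZA : Z * Aᵀ = X - W := by rw [hX, add_sub_cancel_right]
  set a' := a - pcProj U k *ᵥ a with ha'
  have e1 := pcInv_mulVec_factor (a := a) hU hX hk
  have e2 : Z *ᵥ (Aᵀ *ᵥ a - Aᵀ *ᵥ (pcInv X U k *ᵥ (Z *ᵥ (Aᵀ *ᵥ a) + e))) =
      (X *ᵥ a' - W *ᵥ a') + ((Z * Aᵀ * pcInv X U k) *ᵥ (W *ᵥ a) -
        (Z * Aᵀ * pcInv X U k) *ᵥ e) := by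
    have e3 : Aᵀ *ᵥ a - Aᵀ *ᵥ (pcInv X U k *ᵥ (Z *ᵥ (Aᵀ *ᵥ a) + e)) =
        Aᵀ *ᵥ (a' + pcInv X U k *ᵥ (W *ᵥ a) - pcInv X U k *ᵥ e) := by
      rw [mulVec_add (pcInv X U k), e1, ← mulVec_sub, ha']
      congr 1; abel
    rw [e3, mulVec_mulVec, mulVec_sub, mulVec_add, ← mulVec_mulVec _ (Z * Aᵀ),
      ← mulVec_mulVec _ (Z * Aᵀ), ← sub_mulVec, ← hZA]
    abel
  have h1 : (X *ᵥ a') ⬝ᵥ (X *ᵥ a') ≤ _ := sq_mulVec_sub_pcProj_le hU k a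
  have h2 : (W *ᵥ a') ⬝ᵥ (W *ᵥ a') ≤ n * δ * (4 * (a ⬝ᵥ a)) := by
    refine (hW a').trans ?_
    gcongr
    have := sq_sub_le a (pcProj U k *ᵥ a)
    have := sq_pcProj_mulVec_le hU k a
    linarith
  have h3 := (sq_factor_pcInv_le hU hX hn hk hq0 hδ hq hW (W *ᵥ a)).trans
    (mul_le_mul_of_nonneg_left hWa (by positivity))
  have h4 := sq_sub_le (X *ᵥ a') (W *ᵥ a')
  have h5 := sq_sub_le ((Z * Aᵀ * pcInv X U k) *ᵥ (W *ᵥ a)) ((Z * Aᵀ * pcInv X U k) *ᵥ e)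
  rw [e2]
  refine (sq_add_le _ _).trans ?_
  linarith

/-- Bookkeeping of constants: `v` and `α` stand for the two parts of the excess risk, `t1` and `t2`
for the squared noise terms, `lam` for `λ̂_{k+1}`. The surplus terms, such as `N q l`, are absorbed
through `N ≤ δ`. -/
theorem excess_arith {n : ℕ} (hn : 0 < n) {N q δ w gw ge a2 l s2 lam v α t1 t2 : ℝ} {k m : ℕ}
    (hN : 0 ≤ N) (hq : 0 ≤ q) (hNδ : N ≤ δ) (hgw : 0 ≤ gw) (hge : 0 ≤ ge) (ha2 : 0 ≤ a2)
    (hl : 0 ≤ l) (hs2 : 0 ≤ s2) (hlam : 0 ≤ lam) (hw : w = 6 * gw * N)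
    (ht1 : t1 ≤ s2 * ge * (2 * k + 8 * l))
    (ht2 : t2 ≤ (2 + 2 * (δ * q)) * (s2 * ge * (2 * m + 8 * l)))
    (hv : 3 / 64 * n * v ≤ 4 * (n * lam + 4 * (n * δ) + (2 + 2 * (δ * q)) * (n * w)) * a2 + 4 * t2)
    (hα : α ≤ N * (4 * (1 + q * w) * a2 + 2 * (q / n * t1))) :
    v + α ≤ 4000 * (1 + ge) * (1 + gw) *
      ((N * q * k + (1 + δ * q) * (m + l)) * (s2 / n) + (N * q * δ + δ + lam) * a2) := by
  have hn' : (0 : ℝ) < n := by exact_mod_cast hn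
  have hδ : 0 ≤ δ := hN.trans hNδ
  set r := s2 / n with hr
  have hr0 : 0 ≤ r := by positivity
  have hv' : v ≤ 64 / 3 * (4 * (lam + 4 * δ + (2 + 2 * (δ * q)) * w) * a2 +
      4 * ((2 + 2 * (δ * q)) * (ge * (2 * m + 8 * l)) * r)) := by
    have h1 : 3 / 64 * n * v ≤ 3 / 64 * n * (64 / 3 * (4 * (lam + 4 * δ +
        (2 + 2 * (δ * q)) * w) * a2 + 4 * ((2 + 2 * (δ * q)) * (ge * (2 * m + 8 * l)) * r))) := by
      refine (hv.trans (add_le_add_right (mul_le_mul_of_nonneg_left ht2 (by norm_num)) _)).trans_eq ?_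
      rw [hr]; field_simp
    exact le_of_mul_le_mul_left h1 (by positivity)
  have hα' : α ≤ N * (4 * (1 + q * w) * a2 + 2 * (q * (ge * (2 * k + 8 * l)) * r)) := by
    refine hα.trans (mul_le_mul_of_nonneg_left (add_le_add_right ?_ _) hN)
    refine (mul_le_mul_of_nonneg_left (mul_le_mul_of_nonneg_left ht1
      (show 0 ≤ q / n by positivity)) (by norm_num)).trans_eq ?_
    rw [hr]; field_simp
  subst hw
  have hm : (0 : ℝ) ≤ m := by positivity
  have hk : (0 : ℝ) ≤ k := by positivity
  -- the bias terms
  have hbias : 64 / 3 * (4 * (lam + 4 * δ + (2 + 2 * (δ * q)) * (6 * gw * N))) +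
      N * (4 * (1 + q * (6 * gw * N))) ≤
      4000 * (1 + gw) * (N * q * δ + δ + lam) := by
    have i1 : gw * N ≤ gw * δ := mul_le_mul_of_nonneg_left hNδ hgw
    have i2 : gw * (N * q) * N ≤ gw * (N * q) * δ := mul_le_mul_of_nonneg_left hNδ (by positivity)
    have p1 : 0 ≤ gw * (N * q * δ) := by positivity
    have p2 : 0 ≤ gw * δ := by positivity
    have p3 : 0 ≤ gw * lam := by positivity
    have p4 : 0 ≤ N * q * δ := by positivity
    linarith
  -- the noise terms
  have hnoise : 64 / 3 * (4 * ((2 + 2 * (δ * q)) * (2 * m + 8 * l))) +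
      N * (2 * (q * (2 * k + 8 * l))) ≤ 4000 * (N * q * k + (1 + δ * q) * (m + l)) := by
    have i1 : N * (q * l) ≤ δ * (q * l) := mul_le_mul_of_nonneg_right hNδ (by positivity)
    have p1 : 0 ≤ δ * q * m := by positivity
    have p2 : 0 ≤ δ * q * l := by positivity
    have p3 : 0 ≤ N * q * k := by positivity
    linarith
  have hB2 : 0 ≤ N * q * δ + δ + lam := by positivity
  have hB1 : 0 ≤ N * q * k + (1 + δ * q) * (m + l) := by positivity
  have f1 := mul_le_mul_of_nonneg_right hbias ha2
  have f2 := mul_le_mul_of_nonneg_right hnoise (show 0 ≤ ge * r by positivity)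
  have g1 : 4000 * (1 + gw) * (N * q * δ + δ + lam) * a2 ≤
      4000 * (1 + ge) * (1 + gw) * ((N * q * δ + δ + lam) * a2) := by
    have : 0 ≤ ge * ((1 + gw) * ((N * q * δ + δ + lam) * a2)) := by positivity
    linarith
  have g2 : 4000 * (N * q * k + (1 + δ * q) * (m + l)) * (ge * r) ≤
      4000 * (1 + ge) * (1 + gw) * ((N * q * k + (1 + δ * q) * (m + l)) * r) := by
    have h1 : 0 ≤ (N * q * k + (1 + δ * q) * (m + l)) * r := by positivity
    have : 0 ≤ (1 + gw + ge * gw) * ((N * q * k + (1 + δ * q) * (m + l)) * r) := by positivity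
    linarith
  linarith

end

/-! ### Moments of the latent variables and the prediction risk -/

section

variable {Ω : Type*} [MeasurableSpace Ω] {P : Measure Ω}

theorem CenteredWithSecondMoment.memLp_dotProduct {d : ℕ} {V : Ω → Fin d → ℝ}
    {S : Matrix (Fin d) (Fin d) ℝ} (h : CenteredWithSecondMoment P V S) (v : Fin d → ℝ) :
    MemLp (fun ω => V ω ⬝ᵥ v) 2 P := by
  simp only [dotProduct]
  exact memLp_finsetSum _ fun i _ => (h.memLp i).mul_const (v i)

theorem CenteredWithSecondMoment.integral_dotProduct [IsProbabilityMeasure P] {d : ℕ}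
    {V : Ω → Fin d → ℝ} {S : Matrix (Fin d) (Fin d) ℝ} (h : CenteredWithSecondMoment P V S)
    (v : Fin d → ℝ) : ∫ ω, V ω ⬝ᵥ v ∂P = 0 := by
  simp only [dotProduct]
  rw [integral_finsetSum _ fun i _ => ((h.memLp i).integrable (by norm_num)).mul_const _]
  simp [integral_mul_const, h.mean_zero]

theorem CenteredWithSecondMoment.integral_sq {d : ℕ} {V : Ω → Fin d → ℝ}
    {S : Matrix (Fin d) (Fin d) ℝ} (h : CenteredWithSecondMoment P V S) (v : Fin d → ℝ) :
    ∫ ω, (V ω ⬝ᵥ v) ^ 2 ∂P = v ⬝ᵥ S *ᵥ v := by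
  have e : ∀ ω, (V ω ⬝ᵥ v) ^ 2 = ∑ i, ∑ j, v i * v j * (V ω i * V ω j) := by
    intro ω
    rw [sq, dotProduct, Finset.sum_mul_sum]
    exact Finset.sum_congr rfl fun i _ => Finset.sum_congr rfl fun j _ => by ring
  have hi : ∀ i j, Integrable (fun ω => v i * v j * (V ω i * V ω j)) P := fun i j =>
    ((h.memLp i).integrable_mul (h.memLp j)).const_mul _
  simp_rw [e]
  rw [integral_finsetSum _ fun i _ => integrable_finsetSum _ fun j _ => hi i j, dotProduct]
  refine Finset.sum_congr rfl fun i _ => ?_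
  rw [integral_finsetSum _ fun j _ => hi i j, Matrix.mulVec, dotProduct, Finset.mul_sum]
  refine Finset.sum_congr rfl fun j _ => ?_
  rw [integral_const_mul, h.second_moment]; ring

theorem CenteredWithSecondMoment.posSemidef {d : ℕ} {V : Ω → Fin d → ℝ}
    {S : Matrix (Fin d) (Fin d) ℝ} (h : CenteredWithSecondMoment P V S) : S.PosSemidef := by
  refine PosSemidef.of_dotProduct_mulVec_nonneg ?_ fun v => ?_
  · ext i j
    rw [conjTranspose_apply, star_trivial, ← h.second_moment, ← h.second_moment]
    simp_rw [mul_comm]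
  · rw [star_trivial, ← h.integral_sq]
    exact integral_nonneg fun ω => sq_nonneg _

theorem HasSubgaussianMGF.lintegral_exp_le {x : Ω → ℝ} {c : ℝ≥0} (h : HasSubgaussianMGF x c P)
    (t : ℝ) : ∫⁻ ω, ENNReal.ofReal (Real.exp (t * x ω)) ∂P ≤
      ENNReal.ofReal (Real.exp (c * t ^ 2 / 2)) := by
  rw [← ofReal_integral_eq_lintegral_ofReal (h.integrable_exp_mul t)
    (ae_of_all _ fun _ => (Real.exp_pos _).le)]
  exact ENNReal.ofReal_le_ofReal (h.mgf_le t)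

theorem SubGaussianVector.laplaceBound [IsProbabilityMeasure P] {d : ℕ} {V : Ω → Fin d → ℝ}
    {γ : ℝ≥0} (h : SubGaussianVector P V γ) : LaplaceBound P V (((γ : ℝ) ^ 2) • 1) := by
  intro v
  by_cases hv : v = 0
  · simp [hv]
  have hv0 : 0 < v ⬝ᵥ v := lt_of_le_of_ne (dotProduct_self_nonneg' v)
    (fun e => hv (dotProduct_self_eq_zero.1 e.symm))
  set r := √(v ⬝ᵥ v) with hr
  have hr0 : 0 < r := Real.sqrt_pos.2 hv0
  have hr2 : r ^ 2 = v ⬝ᵥ v := Real.sq_sqrt hv0.le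
  have huu : (r⁻¹ • v) ⬝ᵥ (r⁻¹ • v) = 1 := by
    rw [smul_dotProduct, dotProduct_smul, smul_eq_mul, smul_eq_mul, ← hr2]; field_simp
  have h1 := HasSubgaussianMGF.lintegral_exp_le (h _ huu) r
  have e : ∀ ω, r * (V ω ⬝ᵥ r⁻¹ • v) = V ω ⬝ᵥ v := fun ω => by
    rw [dotProduct_smul, smul_eq_mul]; field_simp
  simp_rw [e] at h1
  refine h1.trans_eq ?_
  rw [hr2, smul_mulVec, one_mulVec, dotProduct_smul, smul_eq_mul]
  simp

theorem LaplaceBound.congr {d : ℕ} {V V' : Ω → Fin d → ℝ} {S : Matrix (Fin d) (Fin d) ℝ}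
    (h : LaplaceBound P V S) (h' : ∀ᵐ ω ∂P, V' ω = V ω) : LaplaceBound P V' S := by
  intro v
  rw [lintegral_congr_ae (g := fun ω => ENNReal.ofReal (Real.exp (V ω ⬝ᵥ v)))]
  · exact h v
  · filter_upwards [h'] with ω hω
    rw [hω]

theorem LaplaceBound.map {α : Type*} [MeasurableSpace α] {d : ℕ} {f : α → Fin d → ℝ} {g : Ω → α}
    {S : Matrix (Fin d) (Fin d) ℝ} (hf : Measurable f) (hg : Measurable g)
    (h : LaplaceBound P (fun ω => f (g ω)) S) : LaplaceBound (P.map g) f S := by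
  intro v
  rw [lintegral_map (by simp only [dotProduct]; fun_prop) hg]
  exact h v

open scoped MatrixOrder in
theorem matSqrt_mul_self {d : ℕ} {S : Matrix (Fin d) (Fin d) ℝ} (hS : S.PosSemidef) :
    matSqrt S * matSqrt S = S :=
  CFC.sqrt_mul_sqrt_self S (nonneg_iff_posSemidef.2 hS)

open scoped MatrixOrder in
theorem transpose_matSqrt {d : ℕ} (S : Matrix (Fin d) (Fin d) ℝ) : (matSqrt S)ᵀ = matSqrt S := by
  have h := (nonneg_iff_posSemidef.1 (CFC.sqrt_nonneg S)).1
  rwa [Matrix.IsHermitian, conjTranspose_eq_transpose_of_trivial] at h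

theorem laplaceBound_of_eq_matSqrt {d : ℕ} {V V' : Ω → Fin d → ℝ}
    {S : Matrix (Fin d) (Fin d) ℝ} (hS : S.PosSemidef) {g : ℝ} (h : LaplaceBound P V' (g • 1))
    (hV : ∀ᵐ ω ∂P, V ω = matSqrt S *ᵥ V' ω) : LaplaceBound P V (g • S) := by
  have := (h.mulVec (matSqrt S)).congr hV
  rwa [Matrix.mul_smul, Matrix.mul_one, transpose_matSqrt, Matrix.smul_mul,
    matSqrt_mul_self hS] at this

/-- `Y - Xᵀα = Zᵀ(β - Aᵀα) - Wᵀα + ε`, and the cross terms vanish because the three summands are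
independent and centred. -/
theorem IsFRM.risk_eq [IsProbabilityMeasure P] {p K : ℕ} {θ : Params p K}
    {X : Ω → Fin p → ℝ} {Y : Ω → ℝ} {Z : Ω → Fin K → ℝ} {W : Ω → Fin p → ℝ} {ε : Ω → ℝ}
    (h : IsFRM P θ X Y Z W ε) (α : Fin p → ℝ) :
    risk P X Y α = ENNReal.ofReal ((θ.sigma : ℝ) ^ 2 +
      ((θ.beta - θ.Aᵀ *ᵥ α) ⬝ᵥ θ.SigmaZ *ᵥ (θ.beta - θ.Aᵀ *ᵥ α) + α ⬝ᵥ θ.SigmaW *ᵥ α)) := by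
  set v := θ.beta - θ.Aᵀ *ᵥ α with hv
  have hZ := h.moments_Z.memLp_dotProduct v
  have hW := h.moments_W.memLp_dotProduct α
  have hmZ : Measurable fun z : Fin K → ℝ => z ⬝ᵥ v := by simp only [dotProduct]; fun_prop
  have hmW : Measurable fun w : Fin p → ℝ => w ⬝ᵥ α := by simp only [dotProduct]; fun_prop
  have hD : MemLp (fun ω => Z ω ⬝ᵥ v - W ω ⬝ᵥ α) 2 P := hZ.sub hW
  have hT : MemLp (fun ω => Z ω ⬝ᵥ v - W ω ⬝ᵥ α + ε ω) 2 P := hD.add h.memLp_ε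
  have e : ∀ᵐ ω ∂P, ENNReal.ofReal ((Y ω - X ω ⬝ᵥ α) ^ 2) =
      ENNReal.ofReal ((Z ω ⬝ᵥ v - W ω ⬝ᵥ α + ε ω) ^ 2) := by
    filter_upwards [h.eq_X, h.eq_Y] with ω h1 h2
    have h3 : (θ.A *ᵥ Z ω) ⬝ᵥ α = Z ω ⬝ᵥ (θ.Aᵀ *ᵥ α) := by
      rw [mulVec_transpose, dotProduct_comm, dotProduct_mulVec, dotProduct_comm]
    rw [h1, h2, add_dotProduct, h3, hv, dotProduct_sub]
    congr 2; ring
  rw [risk, lintegral_congr_ae e, ← ofReal_integral_eq_lintegral_ofReal hT.integrable_sq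
    (ae_of_all _ fun _ => sq_nonneg _)]
  congr 1
  have i1 : ∫ ω, (Z ω ⬝ᵥ v) * (W ω ⬝ᵥ α) ∂P = 0 := by
    have hi : IndepFun (fun ω => Z ω ⬝ᵥ v) (fun ω => W ω ⬝ᵥ α) P := h.indep_ZW.comp hmZ hmW
    rw [hi.integral_fun_mul_eq_mul_integral hZ.1 hW.1, h.moments_Z.integral_dotProduct, zero_mul]
  have i2 : ∫ ω, (Z ω ⬝ᵥ v - W ω ⬝ᵥ α) * ε ω ∂P = 0 := by
    have hi : IndepFun (fun ω => Z ω ⬝ᵥ v - W ω ⬝ᵥ α) ε P :=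
      h.indep_ZWε.comp (φ := fun q : (Fin K → ℝ) × (Fin p → ℝ) => q.1 ⬝ᵥ v - q.2 ⬝ᵥ α)
        (ψ := id) ((hmZ.comp measurable_fst).sub (hmW.comp measurable_snd)) measurable_id
    rw [hi.integral_fun_mul_eq_mul_integral hD.1 h.memLp_ε.1, h.mean_ε, mul_zero]
  have j1 : ∫ ω, (Z ω ⬝ᵥ v - W ω ⬝ᵥ α) ^ 2 ∂P =
      v ⬝ᵥ θ.SigmaZ *ᵥ v + α ⬝ᵥ θ.SigmaW *ᵥ α := by
    rw [← h.moments_Z.integral_sq, ← h.moments_W.integral_sq]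
    calc _ = ∫ ω, ((Z ω ⬝ᵥ v) ^ 2 + (W ω ⬝ᵥ α) ^ 2 - 2 * ((Z ω ⬝ᵥ v) * (W ω ⬝ᵥ α))) ∂P := by
          congr 1; ext ω; ring
      _ = ∫ ω, ((Z ω ⬝ᵥ v) ^ 2 + (W ω ⬝ᵥ α) ^ 2) ∂P -
          ∫ ω, 2 * ((Z ω ⬝ᵥ v) * (W ω ⬝ᵥ α)) ∂P :=
          integral_sub (hZ.integrable_sq.add hW.integrable_sq)
            ((hZ.integrable_mul hW).const_mul 2)
      _ = _ := by
          rw [integral_const_mul, i1, integral_add hZ.integrable_sq hW.integrable_sq]; ring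
  calc _ = ∫ ω, ((Z ω ⬝ᵥ v - W ω ⬝ᵥ α) ^ 2 + ε ω ^ 2 +
          2 * ((Z ω ⬝ᵥ v - W ω ⬝ᵥ α) * ε ω)) ∂P := by
        congr 1; ext ω; ring
    _ = ∫ ω, ((Z ω ⬝ᵥ v - W ω ⬝ᵥ α) ^ 2 + ε ω ^ 2) ∂P +
          ∫ ω, 2 * ((Z ω ⬝ᵥ v - W ω ⬝ᵥ α) * ε ω) ∂P :=
        integral_add (hD.integrable_sq.add h.memLp_ε.integrable_sq)
          ((hD.integrable_mul h.memLp_ε).const_mul 2)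
    _ = _ := by
        rw [integral_const_mul, i2, integral_add hD.integrable_sq h.memLp_ε.integrable_sq, j1,
          h.second_moment_ε]
        ring

end

/-! ### The law of the sample -/

/-- The data `(X_i, Y_i)` as a function of the latent variables. -/
noncomputable def Params.dataOf {n p K : ℕ} (θ : Params p K)
    (l : (Fin n → (Fin K → ℝ) × (Fin p → ℝ)) × (Fin n → ℝ)) (i : Fin n) : (Fin p → ℝ) × ℝ :=
  (θ.A *ᵥ (l.1 i).1 + (l.1 i).2, (l.1 i).1 ⬝ᵥ θ.beta + l.2 i)

theorem Params.measurable_dataOf {n p K : ℕ} (θ : Params p K) :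
    Measurable (θ.dataOf (n := n)) := by
  refine measurable_pi_lambda _ fun i => ?_
  simp only [Params.dataOf]
  refine Measurable.prodMk (measurable_pi_lambda _ fun j => ?_) ?_
  · simp only [Pi.add_apply, Matrix.mulVec, dotProduct]; fun_prop
  · simp only [dotProduct]; fun_prop

/-- The sample space need not carry latent variables. Since the failure event depends on the data
only, it may be evaluated on a product space where `(𝐙, 𝐖)` and the noise exist and are independent.
-/
theorem map_sample_eq {Ω₀ Ω : Type*} [MeasurableSpace Ω₀] [MeasurableSpace Ω]
    {P₀ : Measure Ω₀} [IsProbabilityMeasure P₀] {P : Measure Ω} [IsProbabilityMeasure P]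
    {n p K : ℕ} {θ : Params p K} {X₀ : Ω₀ → Fin p → ℝ} {Y₀ : Ω₀ → ℝ}
    {Z : Ω₀ → Fin K → ℝ} {W : Ω₀ → Fin p → ℝ} {ε : Ω₀ → ℝ} (h : IsFRM P₀ θ X₀ Y₀ Z W ε)
    {X : Ω → Matrix (Fin n) (Fin p) ℝ} {Y : Ω → Fin n → ℝ} (hs : IsIIDSample P₀ P X₀ Y₀ X Y) :
    P.map (fun ω i => ((X ω i, Y ω i) : (Fin p → ℝ) × ℝ)) =
      ((Measure.pi fun _ : Fin n => P₀.map fun ω => (Z ω, W ω)).prod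
        (Measure.pi fun _ : Fin n => P₀.map ε)).map θ.dataOf := by
  have hZW : Measurable fun ω => (Z ω, W ω) := h.moments_Z.measurable.prodMk h.moments_W.measurable
  have := Measure.isProbabilityMeasure_map (μ := P₀) hZW.aemeasurable
  have := Measure.isProbabilityMeasure_map (μ := P₀) h.measurable_ε.aemeasurable
  have hmeas : ∀ i, Measurable fun ω => ((X ω i, Y ω i) : (Fin p → ℝ) × ℝ) := fun i =>
    (measurable_pi_lambda _ fun j => hs.measurable_X i j).prodMk (hs.measurable_Y i)
  let g : ((Fin K → ℝ) × (Fin p → ℝ)) × ℝ → (Fin p → ℝ) × ℝ := fun l =>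
    (θ.A *ᵥ l.1.1 + l.1.2, l.1.1 ⬝ᵥ θ.beta + l.2)
  have hg : Measurable g := by
    refine Measurable.prodMk (measurable_pi_lambda _ fun j => ?_) ?_
    · simp only [Pi.add_apply, Matrix.mulVec, dotProduct]; fun_prop
    · simp only [dotProduct]; fun_prop
  have hlaw : P₀.map (fun ω => (X₀ ω, Y₀ ω)) =
      ((P₀.map fun ω => (Z ω, W ω)).prod (P₀.map ε)).map g := by
    rw [← (indepFun_iff_map_prod_eq_prod_map_map hZW.aemeasurable
      h.measurable_ε.aemeasurable).1 h.indep_ZWε, Measure.map_map hg (hZW.prodMk h.measurable_ε)]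
    refine Measure.map_congr ?_
    filter_upwards [h.eq_X, h.eq_Y] with ω h1 h2
    simp only [Function.comp, g, h1, h2]
  rw [(iIndepFun_iff_map_fun_eq_pi_map fun i => (hmeas i).aemeasurable).1 hs.indep]
  have hpi : (fun i => P.map fun ω => ((X ω i, Y ω i) : (Fin p → ℝ) × ℝ)) =
      fun _ : Fin n => ((P₀.map fun ω => (Z ω, W ω)).prod (P₀.map ε)).map g := by
    funext i
    rw [(hs.identDistrib i).map_eq, hlaw]
  have := Measure.isProbabilityMeasure_map (μ := (P₀.map fun ω => (Z ω, W ω)).prod (P₀.map ε))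
    hg.aemeasurable
  rw [hpi, ← Measure.pi_map_pi fun _ => hg.aemeasurable,
    ← (measurePreserving_arrowProdEquivProdArrow ((Fin K → ℝ) × (Fin p → ℝ)) ℝ (Fin n)
      (fun _ => P₀.map fun ω => (Z ω, W ω)) (fun _ => P₀.map ε)).map_eq,
    Measure.map_map θ.measurable_dataOf (MeasurableEquiv.measurable _)]
  rfl

/-! ### Noise bounds -/

theorem measure_noise_gt_le {β : Type*} [MeasurableSpace β] {μ : Measure β}
    [IsProbabilityMeasure μ] {ν : Measure ℝ} [IsProbabilityMeasure ν] {c : ℝ} (hc : 0 ≤ c)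
    (hν : ∀ t, ∫⁻ e, ENNReal.ofReal (Real.exp (t * e)) ∂ν ≤
      ENNReal.ofReal (Real.exp (c * t ^ 2 / 2))) {n r : ℕ}
    {G : β → Matrix (Fin n) (Fin n) ℝ} (hG : ∀ i j, Measurable fun b => G b i j)
    (hr : ∀ b, (G b).rank ≤ r) {t : ℝ} (ht : 0 ≤ t) :
    (μ.prod (Measure.pi fun _ : Fin n => ν)) {l | opNorm (G l.1 * (G l.1)ᵀ) *
      (c * (2 * r + 4 * t)) < (G l.1 *ᵥ l.2) ⬝ᵥ (G l.1 *ᵥ l.2)} ≤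
      ENNReal.ofReal (Real.exp (-t)) := by
  have hm1 : Measurable fun l : β × (Fin n → ℝ) => opNorm (G l.1 * (G l.1)ᵀ) :=
    (measurable_opNorm_mul_transpose hG).comp measurable_fst
  have hm2 : Measurable fun l : β × (Fin n → ℝ) => (G l.1 *ᵥ l.2) ⬝ᵥ (G l.1 *ᵥ l.2) := by
    simp only [dotProduct, Matrix.mulVec]
    have : ∀ i j, Measurable fun l : β × (Fin n → ℝ) => G l.1 i j := fun i j =>
      (hG i j).comp measurable_fst
    fun_prop
  -- Fubini: for frozen `b` the matrix `G b` is deterministic and the tail bound applies with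
  -- covariance proxy `c G Gᵀ`.
  rw [Measure.prod_apply (measurableSet_lt (hm1.mul_const _) hm2)]
  calc _ ≤ ∫⁻ _, ENNReal.ofReal (Real.exp (-t)) ∂μ := lintegral_mono fun b => ?_
    _ = _ := by simp
  have h1 := (laplaceBound_pi (n := n) (x := id) measurable_id hν).mulVec (G b)
  have hSe : G b * (c • (1 : Matrix (Fin n) (Fin n) ℝ)) * (G b)ᵀ = c • (G b * (G b)ᵀ) := by
    rw [Matrix.mul_smul, Matrix.mul_one, Matrix.smul_mul]
  rw [hSe] at h1
  have hps : (c • (G b * (G b)ᵀ)).PosSemidef := by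
    have := posSemidef_self_mul_conjTranspose (G b)
    rw [conjTranspose_eq_transpose_of_trivial] at this
    exact this.smul hc
  have hL : ∀ v, v ⬝ᵥ (c • (G b * (G b)ᵀ)) *ᵥ v ≤ c * opNorm (G b * (G b)ᵀ) * (v ⬝ᵥ v) := by
    intro v
    rw [smul_mulVec, dotProduct_smul, smul_eq_mul, mul_assoc]
    exact mul_le_mul_of_nonneg_left (dotProduct_mulVec_le_opNorm _ v) hc
  have hL0 : 0 ≤ c * opNorm (G b * (G b)ᵀ) := mul_nonneg hc (opNorm_nonneg _)
  have hrk : (c • (G b * (G b)ᵀ)).rank ≤ r := by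
    rw [← Matrix.smul_mul]
    refine (rank_mul_le_right _ _).trans ?_
    rw [rank_transpose]
    exact hr b
  have htr := trace_le_rank_mul hps hL0 hL hrk
  refine le_trans (measure_mono fun e he => ?_)
    (h1.measure_sq_gt_le (by simp only [id]; fun_prop) hps hL hL0 ht)
  have he' : opNorm (G b * (G b)ᵀ) * (c * (2 * r + 4 * t)) < (G b *ᵥ e) ⬝ᵥ (G b *ᵥ e) := he
  refine lt_of_le_of_lt ?_ he'
  linarith

/-! ### Measurability of the estimator -/

section

variable {n p K : ℕ} {U : Matrix (Fin n) (Fin p) ℝ → Matrix (Fin p) (Fin p) ℝ}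

/-- The squares are diagonal entries of `Uᵀ𝐗ᵀ𝐗U`, so measurability is inherited from `U`. -/
theorem measurable_singularValue_sq
    (hUm : ∀ i j, Measurable fun M : Fin n → Fin p → ℝ => U (Matrix.of M) i j)
    (hU : ∀ M, IsRightSingularBasis M (U M)) (j : ℕ) :
    Measurable fun M : Fin n → Fin p → ℝ => singularValue (Matrix.of M) (j + 1) ^ 2 := by
  by_cases hj : j < p
  · have : ∀ M : Fin n → Fin p → ℝ, singularValue (Matrix.of M) (j + 1) ^ 2 =
        ((U (of M))ᵀ * (of M)ᵀ * of M * U (of M)) ⟨j, hj⟩ ⟨j, hj⟩ := fun M => by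
      rw [(hU _).conj_gram, diagonal_apply_eq]
    simp_rw [this, Matrix.mul_apply, transpose_apply, of_apply]
    exact Finset.measurable_sum _ fun a _ => Measurable.mul (Finset.measurable_sum _ fun b _ =>
      Measurable.mul (Finset.measurable_sum _ fun c _ => (hUm _ _).mul (by fun_prop))
        (by fun_prop)) (hUm _ _)
  · have : ∀ M : Fin n → Fin p → ℝ, singularValue (Matrix.of M) (j + 1) ^ 2 = 0 := fun M => by
      rw [singularValue, LinearMap.singularValues_of_finrank_le _ (by simpa using hj)]
      norm_num
    simp_rw [this]
    exact measurable_const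

theorem measurable_pcInv
    (hUm : ∀ i j, Measurable fun M : Fin n → Fin p → ℝ => U (Matrix.of M) i j)
    (hU : ∀ M, IsRightSingularBasis M (U M)) (k : ℕ) (i : Fin p) (j : Fin n) :
    Measurable fun M : Fin n → Fin p → ℝ => pcInv (of M) (U (of M)) k i j := by
  simp only [pcInv, Matrix.mul_apply, transpose_apply, of_apply, diagonal_apply]
  refine Finset.measurable_sum _ fun a _ => Measurable.mul (Finset.measurable_sum _ fun b _ =>
    Measurable.mul (Finset.measurable_sum _ fun c _ => (hUm i c).mul ?_) (hUm a b)) (by fun_prop)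
  split_ifs
  · exact (measurable_singularValue_sq hUm hU c).inv
  · exact measurable_const
  · exact measurable_const

theorem measurable_lambdaHat
    (hUm : ∀ i j, Measurable fun M : Fin n → Fin p → ℝ => U (Matrix.of M) i j)
    (hU : ∀ M, IsRightSingularBasis M (U M)) (k : ℕ) :
    Measurable fun M : Fin n → Fin p → ℝ => lambdaHat (of M) k := by
  unfold lambdaHat
  split_ifs with h
  · exact measurable_const
  · obtain ⟨j, rfl⟩ := Nat.exists_eq_succ_of_ne_zero h
    exact ((measurable_singularValue_sq hUm hU j).div_const _).ennreal_ofReal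

theorem measurableSet_le_rank
    (hUm : ∀ i j, Measurable fun M : Fin n → Fin p → ℝ => U (Matrix.of M) i j)
    (hU : ∀ M, IsRightSingularBasis M (U M)) (k : ℕ) :
    MeasurableSet {M : Fin n → Fin p → ℝ | k ≤ (of M).rank} := by
  rcases k with _ | j
  · simp
  · have : {M : Fin n → Fin p → ℝ | j + 1 ≤ (of M).rank} =
        {M | 0 < singularValue (of M) (j + 1) ^ 2} := by
      ext M
      simp only [Set.mem_ofPred_eq, Nat.succ_le_iff]
      rw [← singularValue_pos_iff]
      have h0 : 0 ≤ singularValue (of M) (j + 1) := LinearMap.singularValues_nonneg _ _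
      exact ⟨fun h => pow_pos h 2, fun h => lt_of_le_of_ne h0 fun e => by simp [← e] at h⟩
    rw [this]
    exact measurableSet_lt measurable_const (measurable_singularValue_sq hUm hU j)

/-- The event that the risk bound with constant `D` fails for some `k ≤ rank 𝐗`. -/
def failureSet {Ω₀ : Type*} [MeasurableSpace Ω₀] (P₀ : Measure Ω₀) (X₀ : Ω₀ → Fin p → ℝ)
    (Y₀ : Ω₀ → ℝ) (θ : Params p K) (U : Matrix (Fin n) (Fin p) ℝ → Matrix (Fin p) (Fin p) ℝ)
    (cW D : ℝ) : Set (Fin n → (Fin p → ℝ) × ℝ) :=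
  ⋃ k : ℕ, {d | k ≤ (of fun i => (d i).1).rank} ∩
    {d | ENNReal.ofReal D * (B1 θ cW (of fun i => (d i).1) k + B2 θ cW (of fun i => (d i).1) k) <
      risk P₀ X₀ Y₀ (pcInv (of fun i => (d i).1) (U (of fun i => (d i).1)) k *ᵥ fun i => (d i).2) -
        ENNReal.ofReal ((θ.sigma : ℝ) ^ 2)}

theorem measurableSet_failureSet {Ω₀ : Type*} [MeasurableSpace Ω₀] {P₀ : Measure Ω₀}
    [IsProbabilityMeasure P₀] {X₀ : Ω₀ → Fin p → ℝ} {Y₀ : Ω₀ → ℝ} {θ : Params p K}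
    {Z : Ω₀ → Fin K → ℝ} {W : Ω₀ → Fin p → ℝ} {ε : Ω₀ → ℝ} (h : IsFRM P₀ θ X₀ Y₀ Z W ε)
    (hUm : ∀ i j, Measurable fun M : Fin n → Fin p → ℝ => U (Matrix.of M) i j)
    (hU : ∀ M, IsRightSingularBasis M (U M)) (cW D : ℝ) :
    MeasurableSet (failureSet P₀ X₀ Y₀ θ U cW D) := by
  have hd : Measurable fun (d : Fin n → (Fin p → ℝ) × ℝ) (i : Fin n) => (d i).1 := by fun_prop
  refine MeasurableSet.iUnion fun k => MeasurableSet.inter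
    (hd (measurableSet_le_rank hUm hU k)) (measurableSet_lt ?_ ?_)
  · have h1 := (measurable_lambdaHat hUm hU k).comp hd
    have h2 := (measurable_lambdaHat hUm hU (k + 1)).comp hd
    simp only [Function.comp_def] at h1 h2
    unfold B1 B2
    fun_prop
  · simp_rw [h.risk_eq]
    have h1 : ∀ i, Measurable fun d : Fin n → (Fin p → ℝ) × ℝ =>
        (pcInv (of fun i => (d i).1) (U (of fun i => (d i).1)) k *ᵥ fun i => (d i).2) i := by
      intro i
      simp only [Matrix.mulVec, dotProduct]
      refine Finset.measurable_sum _ fun j _ => Measurable.mul ?_ (by fun_prop)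
      exact (measurable_pcInv hUm hU k i j).comp hd
    have hquad : Measurable fun α : Fin p → ℝ => ENNReal.ofReal ((θ.sigma : ℝ) ^ 2 +
        ((θ.beta - θ.Aᵀ *ᵥ α) ⬝ᵥ θ.SigmaZ *ᵥ (θ.beta - θ.Aᵀ *ᵥ α) + α ⬝ᵥ θ.SigmaW *ᵥ α)) -
          ENNReal.ofReal ((θ.sigma : ℝ) ^ 2) := by
      simp only [dotProduct, Matrix.mulVec, Pi.sub_apply]
      fun_prop
    exact hquad.comp (measurable_pi_lambda _ h1)

end

/-! ### The bounds as real numbers -/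

theorem B1_add_B2_eq {n p K : ℕ} (θ : Params p K) {cW : ℝ} (hcW : 0 ≤ cW) (hn : 0 < n)
    (htr : 0 ≤ θ.SigmaW.trace) (hβ : 0 ≤ θ.beta ⬝ᵥ ((θ.Aᵀ * θ.A)⁻¹ *ᵥ θ.beta))
    {X : Matrix (Fin n) (Fin p) ℝ} {k : ℕ} (hk : k ≤ X.rank) :
    ∃ q : ℝ, 0 ≤ q ∧ (∀ j < k, 1 ≤ q / n * singularValue X (j + 1) ^ 2) ∧
      B1 θ cW X k + B2 θ cW X k = ENNReal.ofReal
        ((opNorm θ.SigmaW * q * k +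
          (1 + cW * (opNorm θ.SigmaW + θ.SigmaW.trace / n) * q) * ((min K k : ℕ) + Real.log n)) *
            ((θ.sigma : ℝ) ^ 2 / n) +
          (opNorm θ.SigmaW * q * (cW * (opNorm θ.SigmaW + θ.SigmaW.trace / n)) +
            cW * (opNorm θ.SigmaW + θ.SigmaW.trace / n) + singularValue X (k + 1) ^ 2 / n) *
            (θ.beta ⬝ᵥ ((θ.Aᵀ * θ.A)⁻¹ *ᵥ θ.beta))) := by
  have hn' : (0 : ℝ) < n := by exact_mod_cast hn
  have hN := opNorm_nonneg θ.SigmaW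
  have hl : 0 ≤ Real.log n := Real.log_natCast_nonneg n
  set N := opNorm θ.SigmaW with hNdef
  set δ := cW * (N + θ.SigmaW.trace / n) with hδdef
  have hδ : 0 ≤ δ := by positivity
  obtain ⟨q, hq0, hqj, hq⟩ : ∃ q : ℝ, 0 ≤ q ∧
      (∀ j < k, 1 ≤ q / n * singularValue X (j + 1) ^ 2) ∧
      ∀ x : ℝ, 0 ≤ x → ENNReal.ofReal x / lambdaHat X k = ENNReal.ofReal (x * q) := by
    rcases k with _ | k
    -- The convention `λ̂_0 = ∞` corresponds to `q = 0`.
    · exact ⟨0, le_rfl, by simp, fun x _ => by simp [lambdaHat]⟩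
    · have hpos : 0 < singularValue X (k + 1) ^ 2 := pow_pos ((singularValue_pos_iff X k).2 hk) 2
      refine ⟨n / singularValue X (k + 1) ^ 2, by positivity, fun j hj => ?_, fun x hx => ?_⟩
      · have := singularValue_sq_antitone X (Nat.lt_succ_iff.1 hj)
        rw [div_div, mul_comm _ (n : ℝ), ← div_div, div_self hn'.ne', one_div_mul_eq_div,
          le_div_iff₀ hpos, one_mul]
        exact this
      · rw [lambdaHat, if_neg (Nat.succ_ne_zero k), ← ENNReal.ofReal_div_of_pos (by positivity)]
        congr 1
        field_simp
  refine ⟨q, hq0, hqj, ?_⟩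
  have hB1 : B1 θ cW X k = ENNReal.ofReal ((N * q * k + (1 + δ * q) * ((min K k : ℕ) +
      Real.log n)) * ((θ.sigma : ℝ) ^ 2 / n)) := by
    rw [B1, Params.noiseNorm, Params.deltaW, hq _ hN, hq _ hδ, ← ENNReal.ofReal_natCast k,
      ← ENNReal.ofReal_natCast (min K k), ← ENNReal.ofReal_one,
      ← ENNReal.ofReal_mul (by positivity), ← ENNReal.ofReal_add (by positivity) (by positivity),
      ← ENNReal.ofReal_add (by positivity) (by positivity), ← ENNReal.ofReal_mul (by positivity),
      ← ENNReal.ofReal_add (by positivity) (by positivity), ← ENNReal.ofReal_mul (by positivity)]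
  have hB2 : B2 θ cW X k = ENNReal.ofReal ((N * q * δ + δ + singularValue X (k + 1) ^ 2 / n) *
      (θ.beta ⬝ᵥ ((θ.Aᵀ * θ.A)⁻¹ *ᵥ θ.beta))) := by
    rw [B2, Params.noiseNorm, Params.deltaW, hq _ hN, Params.betaQuad, lambdaHat,
      if_neg (Nat.succ_ne_zero k),
      ← ENNReal.ofReal_mul (by positivity), ← ENNReal.ofReal_add (by positivity) (by positivity),
      ← ENNReal.ofReal_add (by positivity) (by positivity), ← ENNReal.ofReal_mul (by positivity)]
  rw [hB1, hB2, ← ENNReal.ofReal_add (by positivity) (by positivity)]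

/-! ### The risk bound on the latent space -/

theorem isUnit_det_of_rank_eq {d : ℕ} {M : Matrix (Fin d) (Fin d) ℝ} (h : M.rank = d) :
    IsUnit M.det := by
  rw [← isUnit_iff_isUnit_det, ← mulVec_surjective_iff_isUnit]
  have : LinearMap.range M.mulVecLin = ⊤ := by
    apply Submodule.eq_top_of_finrank_eq
    rw [Module.finrank_fin_fun]
    exact h
  exact LinearMap.range_eq_top.1 this

theorem exists_factor_preimage {p K : ℕ} {A : Matrix (Fin p) (Fin K) ℝ} (hA : A.rank = K)
    (β : Fin K → ℝ) : ∃ a : Fin p → ℝ, Aᵀ *ᵥ a = β ∧ a ⬝ᵥ a = β ⬝ᵥ ((Aᵀ * A)⁻¹ *ᵥ β) := by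
  have hdet : IsUnit (Aᵀ * A).det := isUnit_det_of_rank_eq (by rw [rank_transpose_mul_self, hA])
  have h1 : (Aᵀ * A) *ᵥ ((Aᵀ * A)⁻¹ *ᵥ β) = β := by
    rw [mulVec_mulVec, mul_nonsing_inv _ hdet, one_mulVec]
  refine ⟨A *ᵥ ((Aᵀ * A)⁻¹ *ᵥ β), by rw [mulVec_mulVec, h1], ?_⟩
  rw [dotProduct_mulVec, vecMul_mulVec, ← mulVec_transpose, transpose_mul, transpose_transpose, h1]

theorem one_div_of_exp_log {n : ℕ} (hn : 0 < n) : Real.exp (-Real.log n) = 1 / n := by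
  rw [Real.exp_neg, Real.exp_log (by exact_mod_cast hn), one_div]

/-- Whitening: `Σ_Z^{-1/2} Z` agrees almost surely with the isotropic vector `Z'`, so the isotropic
lower bound applies and is then evaluated at `Σ_Z^{1/2} v`. -/
theorem exists_measure_factor_lower_le (γz : ℝ≥0) (hγ : 0 < γz) : ∃ C : ℝ, 0 < C ∧
    ∀ {Ω₀ : Type*} [MeasurableSpace Ω₀] {P₀ : Measure Ω₀} [IsProbabilityMeasure P₀]
      {n p K : ℕ} {θ : Params p K} {X₀ : Ω₀ → Fin p → ℝ} {Y₀ : Ω₀ → ℝ}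
      {Z Z' : Ω₀ → Fin K → ℝ} {W : Ω₀ → Fin p → ℝ} {ε : Ω₀ → ℝ},
      2 ≤ n → (K : ℝ) * Real.log n ≤ C * n → IsFRM P₀ θ X₀ Y₀ Z W ε →
      CenteredWithSecondMoment P₀ Z' 1 → SubGaussianVector P₀ Z' γz →
      (∀ᵐ ω ∂P₀, Z ω = matSqrt θ.SigmaZ *ᵥ Z' ω) →
      (Measure.pi fun _ : Fin n => P₀.map fun ω => (Z ω, W ω)) {b | ¬ ∀ v,
        3 / 64 * n * (v ⬝ᵥ θ.SigmaZ *ᵥ v) ≤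
          ((of fun i => (b i).1) *ᵥ v) ⬝ᵥ ((of fun i => (b i).1) *ᵥ v)} ≤
      ENNReal.ofReal (2 / n) := by
  obtain ⟨C, hC0, hC⟩ := exists_measure_rows_lower_le ((γz : ℝ) ^ 2) (by positivity)
  refine ⟨C, hC0, ?_⟩
  intro Ω₀ _ P₀ _ n p K θ X₀ Y₀ Z Z' W ε hn hK h hZ' hsub hZ
  set S := matSqrt θ.SigmaZ with hS
  have hSS : S * S = θ.SigmaZ := matSqrt_mul_self h.moments_Z.posSemidef
  have hSt : Sᵀ = S := transpose_matSqrt _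
  have hSdet : IsUnit S.det := by
    have := isUnit_det_of_rank_eq h.rank_SigmaZ
    rw [← hSS, det_mul] at this
    exact isUnit_of_mul_isUnit_left this
  have hZW : Measurable fun ω => (Z ω, W ω) := h.moments_Z.measurable.prodMk h.moments_W.measurable
  have := Measure.isProbabilityMeasure_map (μ := P₀) hZW.aemeasurable
  have hf : Measurable fun b : (Fin K → ℝ) × (Fin p → ℝ) => S⁻¹ *ᵥ b.1 := by
    refine measurable_pi_lambda _ fun i => ?_
    simp only [Matrix.mulVec, dotProduct]; fun_prop
  have hae : ∀ᵐ ω ∂P₀, S⁻¹ *ᵥ Z ω = Z' ω := by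
    filter_upwards [hZ] with ω hω
    rw [hω, mulVec_mulVec, nonsing_inv_mul _ hSdet, one_mulVec]
  have hm : ∀ v : Fin K → ℝ,
      Measurable fun b : (Fin K → ℝ) × (Fin p → ℝ) => (S⁻¹ *ᵥ b.1) ⬝ᵥ v := fun v => by
    simp only [dotProduct]; fun_prop
  have key := hC n K hn hK (P₀.map fun ω => (Z ω, W ω)) (fun b => S⁻¹ *ᵥ b.1)
    (LaplaceBound.map hf hZW (hsub.laplaceBound.congr hae)) hf
    (fun v => by
      rw [memLp_map_measure_iff (hm v).aestronglyMeasurable hZW.aemeasurable]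
      refine (memLp_congr_ae ?_).1 (hZ'.memLp_dotProduct v)
      filter_upwards [hae] with ω hω
      simp only [Function.comp, hω])
    (fun v => by
      rw [integral_map hZW.aemeasurable ((hm v).pow_const 2).aestronglyMeasurable]
      rw [integral_congr_ae (g := fun ω => (Z' ω ⬝ᵥ v) ^ 2), hZ'.integral_sq, one_mulVec]
      filter_upwards [hae] with ω hω
      rw [hω])
  refine le_trans (measure_mono ?_) key
  intro b hb hgood
  refine hb fun v => ?_
  have h1 := hgood (S *ᵥ v)
  have e1 : (of fun i => S⁻¹ *ᵥ (b i).1) *ᵥ (S *ᵥ v) = (of fun i => (b i).1) *ᵥ v := by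
    funext i
    change (S⁻¹ *ᵥ (b i).1) ⬝ᵥ (S *ᵥ v) = (b i).1 ⬝ᵥ v
    rw [dotProduct_mulVec, ← mulVec_transpose, hSt, mulVec_mulVec, mul_nonsing_inv _ hSdet,
      one_mulVec]
  have e2 : (S *ᵥ v) ⬝ᵥ (S *ᵥ v) = v ⬝ᵥ θ.SigmaZ *ᵥ v := by
    rw [dotProduct_mulVec, vecMul_mulVec, hSt, hSS, ← dotProduct_mulVec]
  rwa [e1, e2] at h1

section

variable {Ω₀ : Type*} [MeasurableSpace Ω₀] {P₀ : Measure Ω₀} [IsProbabilityMeasure P₀]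
  {n p K : ℕ} {θ : Params p K} {X₀ : Ω₀ → Fin p → ℝ} {Y₀ : Ω₀ → ℝ}
  {Z : Ω₀ → Fin K → ℝ} {W : Ω₀ → Fin p → ℝ} {ε : Ω₀ → ℝ}

theorem dataOf_fst_eq (b : Fin n → (Fin K → ℝ) × (Fin p → ℝ)) (e : Fin n → ℝ) :
    (of fun i => (θ.dataOf (b, e) i).1) =
      (of fun i => (b i).1) * θ.Aᵀ + of fun i => (b i).2 := by
  ext i j
  simp [Params.dataOf, Matrix.mul_apply, Matrix.mulVec, dotProduct, mul_comm]

theorem dataOf_snd_eq (b : Fin n → (Fin K → ℝ) × (Fin p → ℝ)) (e : Fin n → ℝ) :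
    (fun i => (θ.dataOf (b, e) i).2) = (of fun i => (b i).1) *ᵥ θ.beta + e := by
  rfl

/-- The risk bound holds as soon as the sample lies in the good events. -/
theorem risk_sub_le_of_good (h : IsFRM P₀ θ X₀ Y₀ Z W ε) {γε γw : ℝ} (hn : 0 < n)
    {a : Fin p → ℝ} (ha : θ.Aᵀ *ᵥ a = θ.beta)
    (haa : a ⬝ᵥ a = θ.beta ⬝ᵥ ((θ.Aᵀ * θ.A)⁻¹ *ᵥ θ.beta))
    {Zs : Matrix (Fin n) (Fin K) ℝ} {Ws X : Matrix (Fin n) (Fin p) ℝ} {e : Fin n → ℝ}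
    (hX : X = Zs * θ.Aᵀ + Ws) {U : Matrix (Fin p) (Fin p) ℝ} (hU : IsRightSingularBasis X U)
    {k : ℕ} (hk : k ≤ X.rank)
    (hZs : ∀ v, 3 / 64 * n * (v ⬝ᵥ θ.SigmaZ *ᵥ v) ≤ (Zs *ᵥ v) ⬝ᵥ (Zs *ᵥ v))
    (hWs : ∀ v, (Ws *ᵥ v) ⬝ᵥ (Ws *ᵥ v) ≤
      n * ((48 * γw ^ 2 + 1) * (opNorm θ.SigmaW + θ.SigmaW.trace / n)) * (v ⬝ᵥ v))
    (hWa : (Ws *ᵥ a) ⬝ᵥ (Ws *ᵥ a) ≤ n * (6 * γw ^ 2 * opNorm θ.SigmaW) * (a ⬝ᵥ a))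
    (hnoise : ((X * pcInv X U k) *ᵥ e) ⬝ᵥ ((X * pcInv X U k) *ᵥ e) ≤
      opNorm (X * pcInv X U k * (X * pcInv X U k)ᵀ) *
        ((θ.sigma : ℝ) ^ 2 * γε ^ 2 * (2 * k + 8 * Real.log n)))
    (hnoise' : ((Zs * θ.Aᵀ * pcInv X U k) *ᵥ e) ⬝ᵥ ((Zs * θ.Aᵀ * pcInv X U k) *ᵥ e) ≤
      opNorm (Zs * θ.Aᵀ * pcInv X U k * (Zs * θ.Aᵀ * pcInv X U k)ᵀ) *
        ((θ.sigma : ℝ) ^ 2 * γε ^ 2 * (2 * (min K k : ℕ) + 8 * Real.log n))) :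
    risk P₀ X₀ Y₀ (pcInv X U k *ᵥ (Zs *ᵥ θ.beta + e)) - ENNReal.ofReal ((θ.sigma : ℝ) ^ 2) ≤
      ENNReal.ofReal (4000 * (1 + γε ^ 2) * (1 + γw ^ 2)) *
        (B1 θ (48 * γw ^ 2 + 1) X k + B2 θ (48 * γw ^ 2 + 1) X k) := by
  have hn' : (0 : ℝ) < n := by exact_mod_cast hn
  have hN := opNorm_nonneg θ.SigmaW
  have htr : 0 ≤ θ.SigmaW.trace := h.moments_W.posSemidef.trace_nonneg
  have hl : 0 ≤ Real.log n := Real.log_natCast_nonneg n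
  have ha0 := dotProduct_self_nonneg' a
  obtain ⟨q, hq0, hqj, hB⟩ := B1_add_B2_eq θ (cW := 48 * γw ^ 2 + 1) (by positivity) hn htr
    (by rw [← haa]; exact ha0) hk
  rw [← haa] at hB
  set N := opNorm θ.SigmaW
  set δ := (48 * γw ^ 2 + 1) * (N + θ.SigmaW.trace / n) with hδdef
  -- The summand `1` in the constant `48 γw² + 1` is there for this inequality.
  have hNδ : N ≤ δ := by
    have h1 : 0 ≤ θ.SigmaW.trace / n := by positivity
    have h2 : 0 ≤ 48 * γw ^ 2 * (N + θ.SigmaW.trace / n) := by positivity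
    rw [hδdef]; linarith
  have hδ : 0 ≤ δ := hN.trans hNδ
  have hop1 : opNorm (X * pcInv X U k * (X * pcInv X U k)ᵀ) ≤ 1 :=
    opNorm_mul_transpose_le _ zero_le_one fun v => by
      rw [one_mul]; exact sq_mul_pcInv_mulVec_le hU hk v
  have hop2 := opNorm_mul_transpose_le (Zs * θ.Aᵀ * pcInv X U k) (by positivity)
    (sq_factor_pcInv_le hU hX hn hk hq0 hδ hqj hWs)
  have hα := sq_coef_le hU hX hn hk hq0 hqj hWa e
  have hv := sq_residual_le hU hX hn hk hq0 hδ hqj hWs hWa e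
  rw [ha] at hα hv
  set α := pcInv X U k *ᵥ (Zs *ᵥ θ.beta + e)
  have hs : singularValue X (k + 1) ^ 2 = n * (singularValue X (k + 1) ^ 2 / n) := by field_simp
  rw [hs] at hv
  have main := excess_arith (n := n) (k := k) (m := min K k) hn (N := N) (q := q) (δ := δ)
    (gw := γw ^ 2) (ge := γε ^ 2) (a2 := a ⬝ᵥ a) (l := Real.log n) (s2 := (θ.sigma : ℝ) ^ 2)
    hN hq0 hNδ (by positivity) (by positivity) ha0 hl (by positivity)
    (show 0 ≤ singularValue X (k + 1) ^ 2 / n by positivity) rfl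
    (hnoise.trans ((mul_le_mul_of_nonneg_right hop1 (by positivity)).trans_eq (one_mul _)))
    (hnoise'.trans (mul_le_mul_of_nonneg_right hop2 (by positivity)))
    ((hZs _).trans hv)
    ((dotProduct_mulVec_le_opNorm θ.SigmaW α).trans (mul_le_mul_of_nonneg_left hα hN))
  rw [h.risk_eq, hB, ← ENNReal.ofReal_mul (by positivity), tsub_le_iff_right,
    ← ENNReal.ofReal_add (by positivity) (by positivity)]
  apply ENNReal.ofReal_le_ofReal
  linarith

theorem measure_latent_failure_le (h : IsFRM P₀ θ X₀ Y₀ Z W ε) {γε γw : ℝ≥0} (hn : 2 ≤ n)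
    (hε : HasSubgaussianMGF ε ((θ.sigma * γε) ^ 2) P₀)
    (hW : LaplaceBound P₀ W (((γw : ℝ) ^ 2) • θ.SigmaW))
    (hZ : (Measure.pi fun _ : Fin n => P₀.map fun ω => (Z ω, W ω)) {b | ¬ ∀ v,
        3 / 64 * n * (v ⬝ᵥ θ.SigmaZ *ᵥ v) ≤
          ((of fun i => (b i).1) *ᵥ v) ⬝ᵥ ((of fun i => (b i).1) *ᵥ v)} ≤
      ENNReal.ofReal (2 / n))
    {U : Matrix (Fin n) (Fin p) ℝ → Matrix (Fin p) (Fin p) ℝ}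
    (hUm : ∀ i j, Measurable fun M : Fin n → Fin p → ℝ => U (Matrix.of M) i j)
    (hU : ∀ M, IsRightSingularBasis M (U M)) :
    ((Measure.pi fun _ : Fin n => P₀.map fun ω => (Z ω, W ω)).prod
        (Measure.pi fun _ : Fin n => P₀.map ε))
      (θ.dataOf ⁻¹' failureSet P₀ X₀ Y₀ θ U (48 * (γw : ℝ) ^ 2 + 1)
        (4000 * (1 + (γε : ℝ) ^ 2) * (1 + (γw : ℝ) ^ 2))) ≤ ENNReal.ofReal (8 / n) := by
  have hn0 : 0 < n := by omega
  have hn' : (0 : ℝ) < n := by exact_mod_cast hn0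
  have hn1 : (1 : ℝ) ≤ n := by exact_mod_cast hn0
  have hZW : Measurable fun ω => (Z ω, W ω) := h.moments_Z.measurable.prodMk h.moments_W.measurable
  have := Measure.isProbabilityMeasure_map (μ := P₀) hZW.aemeasurable
  have := Measure.isProbabilityMeasure_map (μ := P₀) h.measurable_ε.aemeasurable
  set μ := P₀.map fun ω => (Z ω, W ω)
  set ν := P₀.map ε
  set N := opNorm θ.SigmaW with hNdef
  have hN : 0 ≤ N := opNorm_nonneg θ.SigmaW
  have hps := h.moments_W.posSemidef
  have htr : 0 ≤ θ.SigmaW.trace := hps.trace_nonneg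
  have hl : 0 ≤ Real.log n := Real.log_natCast_nonneg n
  obtain ⟨a, ha, haa⟩ := exists_factor_preimage h.rank_A θ.beta
  have hWμ : LaplaceBound μ (fun b => b.2) (((γw : ℝ) ^ 2) • θ.SigmaW) :=
    LaplaceBound.map measurable_snd hZW hW
  have hν : ∀ t, ∫⁻ e, ENNReal.ofReal (Real.exp (t * e)) ∂ν ≤
      ENNReal.ofReal (Real.exp ((θ.sigma : ℝ) ^ 2 * (γε : ℝ) ^ 2 * t ^ 2 / 2)) := by
    intro t
    rw [lintegral_map (by fun_prop) h.measurable_ε]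
    refine (HasSubgaussianMGF.lintegral_exp_le hε t).trans_eq ?_
    push_cast
    rw [mul_pow]
  set F1 : Set (Fin n → (Fin K → ℝ) × (Fin p → ℝ)) := {b | ¬ ∀ v,
        3 / 64 * n * (v ⬝ᵥ θ.SigmaZ *ᵥ v) ≤
          ((of fun i => (b i).1) *ᵥ v) ⬝ᵥ ((of fun i => (b i).1) *ᵥ v)}
  set F2 : Set (Fin n → (Fin K → ℝ) × (Fin p → ℝ)) := {b | ¬ ∀ v,
        ((of fun i => (b i).2) *ᵥ v) ⬝ᵥ ((of fun i => (b i).2) *ᵥ v) ≤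
        n * ((48 * (γw : ℝ) ^ 2 + 1) * (N + θ.SigmaW.trace / n)) * (v ⬝ᵥ v)} with hF2
  set F3 : Set (Fin n → (Fin K → ℝ) × (Fin p → ℝ)) := {b |
        n * (6 * (γw : ℝ) ^ 2 * N) * (a ⬝ᵥ a) <
        ((of fun i => (b i).2) *ᵥ a) ⬝ᵥ ((of fun i => (b i).2) *ᵥ a)} with hF3
  have hF2le : (Measure.pi fun _ : Fin n => μ) F2 ≤ ENNReal.ofReal (1 / n) := by
    have h1 := hWμ.measure_rows_opNorm_le (n := n) measurable_snd
      (hps.smul (by positivity)) (L := (γw : ℝ) ^ 2 * N) (by positivity) (fun v => by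
        rw [smul_mulVec, dotProduct_smul, smul_eq_mul, mul_assoc]
        exact mul_le_mul_of_nonneg_left (dotProduct_mulVec_le_opNorm _ v) (by positivity))
    refine (measure_mono ?_).trans (h1.trans ?_)
    · intro b hb hgood
      refine hb fun v => (hgood v).trans ?_
      apply mul_le_mul_of_nonneg_right _ (dotProduct_self_nonneg' v)
      rw [trace_smul, smul_eq_mul]
      have e1 : n * ((48 * (γw : ℝ) ^ 2 + 1) * (N + θ.SigmaW.trace / n)) =
          48 * (γw : ℝ) ^ 2 * (n * N) + 48 * ((γw : ℝ) ^ 2 * θ.SigmaW.trace) + n * N +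
            θ.SigmaW.trace := by
        field_simp; ring
      rw [e1]
      have : 0 ≤ (γw : ℝ) ^ 2 * θ.SigmaW.trace := by positivity
      have : 0 ≤ n * N := by positivity
      linarith
    · apply ENNReal.ofReal_le_ofReal
      rw [Real.exp_neg, one_div]
      exact inv_anti₀ hn' (by linarith [Real.add_one_le_exp (n : ℝ)])
  have hF3le : (Measure.pi fun _ : Fin n => μ) F3 ≤ ENNReal.ofReal (1 / n) := by
    have h0 : a ⬝ᵥ (((γw : ℝ) ^ 2) • θ.SigmaW) *ᵥ a = (γw : ℝ) ^ 2 * (a ⬝ᵥ θ.SigmaW *ᵥ a) := by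
      rw [smul_mulVec, dotProduct_smul, smul_eq_mul]
    have h2 : 0 ≤ a ⬝ᵥ θ.SigmaW *ᵥ a := by simpa using hps.dotProduct_mulVec_nonneg a
    have h1 := hWμ.measure_rows_mulVec_gt_le (n := n) measurable_snd a
      (by rw [h0]; positivity) hl
    rw [one_div_of_exp_log hn0] at h1
    refine (measure_mono fun b hb => ?_).trans h1
    have hb' : n * (6 * (γw : ℝ) ^ 2 * N) * (a ⬝ᵥ a) < _ := hb
    refine lt_of_le_of_lt ?_ hb'
    rw [h0]
    have h3 := dotProduct_mulVec_le_opNorm θ.SigmaW a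
    -- Hence `2n + 4 log n ≤ 6n`, the source of the constant `6`.
    have h4 : Real.log n ≤ n := Real.log_le_self hn'.le
    calc (γw : ℝ) ^ 2 * (a ⬝ᵥ θ.SigmaW *ᵥ a) * (2 * n + 4 * Real.log n)
        ≤ (γw : ℝ) ^ 2 * (N * (a ⬝ᵥ a)) * (2 * n + 4 * n) := by
          have := dotProduct_self_nonneg' a
          gcongr
      _ = _ := by ring
  set Xd : (Fin n → (Fin K → ℝ) × (Fin p → ℝ)) → Matrix (Fin n) (Fin p) ℝ :=
    fun b => (of fun i => (b i).1) * θ.Aᵀ + of fun i => (b i).2 with hXd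
  have hXm : ∀ i j, Measurable fun b => Xd b i j := by
    intro i j
    simp only [hXd, Matrix.add_apply, Matrix.mul_apply, of_apply, transpose_apply]
    fun_prop
  have hRm : ∀ k i j, Measurable fun b => pcInv (Xd b) (U (Xd b)) k i j := fun k i j =>
    (measurable_pcInv hUm hU k i j).comp
      (f := fun b i j => Xd b i j)
      (measurable_pi_lambda _ fun i => measurable_pi_lambda _ fun j => hXm i j)
  set G1 : ℕ → (Fin n → (Fin K → ℝ) × (Fin p → ℝ)) → Matrix (Fin n) (Fin n) ℝ :=
    fun k b => Xd b * pcInv (Xd b) (U (Xd b)) k with hG1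
  set G2 : ℕ → (Fin n → (Fin K → ℝ) × (Fin p → ℝ)) → Matrix (Fin n) (Fin n) ℝ :=
    fun k b => (of fun i => (b i).1) * θ.Aᵀ * pcInv (Xd b) (U (Xd b)) k with hG2
  have hG1m : ∀ k i j, Measurable fun b => G1 k b i j := by
    intro k i j
    simp only [hG1, Matrix.mul_apply]
    exact Finset.measurable_sum _ fun l _ => (hXm i l).mul (hRm k l j)
  have hG2m : ∀ k i j, Measurable fun b => G2 k b i j := by
    intro k i j
    simp only [hG2, Matrix.mul_apply, of_apply, transpose_apply]
    exact Finset.measurable_sum _ fun l _ => Measurable.mul (by fun_prop) (hRm k l j)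
  have hG1r : ∀ k b, (G1 k b).rank ≤ k := fun k b =>
    (rank_mul_le_right _ _).trans (rank_pcInv_le _ _ _)
  have hG2r : ∀ k b, (G2 k b).rank ≤ min K k := fun k b => le_min
    ((rank_mul_le_left _ _).trans ((rank_mul_le_left _ _).trans ((rank_le_width _))))
    ((rank_mul_le_right _ _).trans (rank_pcInv_le _ _ _))
  have hexp : Real.exp (-(2 * Real.log n)) = 1 / n ^ 2 := by
    rw [show -(2 * Real.log n) = -Real.log n + -Real.log n by ring, Real.exp_add,
      one_div_of_exp_log hn0]
    field_simp
  -- The choice `t = 2 log n` gives probability `n⁻²` for each `k`, leaving room for a union over `n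
  -- + 1` values.
  have hE1 := fun k => measure_noise_gt_le (μ := Measure.pi fun _ : Fin n => μ) (ν := ν)
    (c := (θ.sigma : ℝ) ^ 2 * (γε : ℝ) ^ 2) (by positivity) hν (hG1m k) (hG1r k)
    (t := 2 * Real.log n) (by positivity)
  have hE2 := fun k => measure_noise_gt_le (μ := Measure.pi fun _ : Fin n => μ) (ν := ν)
    (c := (θ.sigma : ℝ) ^ 2 * (γε : ℝ) ^ 2) (by positivity) hν (hG2m k) (hG2r k)
    (t := 2 * Real.log n) (by positivity)
  simp only [hexp] at hE1 hE2
  set E1 : ℕ → Set ((Fin n → (Fin K → ℝ) × (Fin p → ℝ)) × (Fin n → ℝ)) := fun k =>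
    {l | opNorm (G1 k l.1 * (G1 k l.1)ᵀ) * ((θ.sigma : ℝ) ^ 2 * (γε : ℝ) ^ 2 *
      (2 * k + 4 * (2 * Real.log n))) < (G1 k l.1 *ᵥ l.2) ⬝ᵥ (G1 k l.1 *ᵥ l.2)} with hE1def
  set E2 : ℕ → Set ((Fin n → (Fin K → ℝ) × (Fin p → ℝ)) × (Fin n → ℝ)) := fun k =>
    {l | opNorm (G2 k l.1 * (G2 k l.1)ᵀ) * ((θ.sigma : ℝ) ^ 2 * (γε : ℝ) ^ 2 *
      (2 * (min K k : ℕ) + 4 * (2 * Real.log n))) < (G2 k l.1 *ᵥ l.2) ⬝ᵥ (G2 k l.1 *ᵥ l.2)}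
    with hE2def
  have hcover : θ.dataOf ⁻¹' failureSet P₀ X₀ Y₀ θ U (48 * (γw : ℝ) ^ 2 + 1)
        (4000 * (1 + (γε : ℝ) ^ 2) * (1 + (γw : ℝ) ^ 2)) ⊆
      (F1 ×ˢ Set.univ ∪ F2 ×ˢ Set.univ ∪ F3 ×ˢ Set.univ) ∪
        ((⋃ k ∈ Finset.range (n + 1), E1 k) ∪ ⋃ k ∈ Finset.range (n + 1), E2 k) := by
    rintro ⟨b, e⟩ hbe
    by_contra hcon
    simp only [Set.mem_union, Set.mem_prod, Set.mem_univ, and_true, Set.mem_iUnion, exists_prop,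
      not_or, not_exists, not_and, Finset.mem_range] at hcon
    obtain ⟨⟨⟨h1, h2⟩, h3⟩, h4, h5⟩ := hcon
    obtain ⟨k, hk, hfail⟩ := Set.mem_iUnion.1 hbe
    simp only [Set.mem_ofPred_eq] at hk hfail
    rw [dataOf_fst_eq] at hk
    simp only [dataOf_fst_eq, dataOf_snd_eq] at hfail
    -- Since `rank 𝐗 ≤ n`, finitely many noise events cover all admissible `k`.
    have hkn : k < n + 1 := Nat.lt_succ_of_le (hk.trans (rank_le_height _))
    refine absurd hfail (not_lt.2 (risk_sub_le_of_good h hn0 ha haa rfl (hU _) hk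
      (not_not.1 h1) (not_not.1 h2) (not_lt.1 h3) ?_ ?_))
    · have h4' := h4 k hkn
      simp only [hE1def, Set.mem_ofPred_eq, not_lt] at h4'
      refine h4'.trans_eq ?_
      simp only [hG1, hXd]; ring
    · have h5' := h5 k hkn
      simp only [hE2def, Set.mem_ofPred_eq, not_lt] at h5'
      refine h5'.trans_eq ?_
      simp only [hG2, hXd]; ring
  refine (measure_mono hcover).trans ?_
  have hsum : ∀ E : ℕ → Set ((Fin n → (Fin K → ℝ) × (Fin p → ℝ)) × (Fin n → ℝ)),
      (∀ k, ((Measure.pi fun _ : Fin n => μ).prod (Measure.pi fun _ : Fin n => ν)) (E k) ≤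
        ENNReal.ofReal (1 / n ^ 2)) →
      ((Measure.pi fun _ : Fin n => μ).prod (Measure.pi fun _ : Fin n => ν))
        (⋃ k ∈ Finset.range (n + 1), E k) ≤ ENNReal.ofReal (2 / n) := by
    intro E hE
    refine (measure_biUnion_finset_le _ _).trans ((Finset.sum_le_sum fun k _ => hE k).trans ?_)
    rw [Finset.sum_const, Finset.card_range, nsmul_eq_mul, ← ENNReal.ofReal_natCast,
      ← ENNReal.ofReal_mul (by positivity)]
    apply ENNReal.ofReal_le_ofReal
    push_cast
    rw [mul_one_div, div_le_div_iff₀ (by positivity) hn']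
    nlinarith
  have hprod : ∀ F, ((Measure.pi fun _ : Fin n => μ).prod (Measure.pi fun _ : Fin n => ν))
      (F ×ˢ Set.univ) = (Measure.pi fun _ : Fin n => μ) F := fun F => by
    rw [Measure.prod_prod, measure_univ, mul_one]
  calc _ ≤ (ENNReal.ofReal (2 / n) + ENNReal.ofReal (1 / n) + ENNReal.ofReal (1 / n)) +
        (ENNReal.ofReal (2 / n) + ENNReal.ofReal (2 / n)) := by
        refine (measure_union_le _ _).trans (add_le_add ((measure_union_le _ _).trans
          (add_le_add ((measure_union_le _ _).trans (add_le_add ?_ ?_)) ?_))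
          ((measure_union_le _ _).trans (add_le_add (hsum _ hE1) (hsum _ hE2))))
        · rw [hprod]; exact hZ
        · rw [hprod]; exact hF2le
        · rw [hprod]; exact hF3le
    _ = _ := by
        rw [← ENNReal.ofReal_add (by positivity) (by positivity),
          ← ENNReal.ofReal_add (by positivity) (by positivity),
          ← ENNReal.ofReal_add (by positivity) (by positivity),
          ← ENNReal.ofReal_add (by positivity) (by positivity)]
        congr 1
        ring

end

end FactorPCR

/-! ### Assembly: from the latent space to the sample, and from all `k` to a random `k`. -/

theorem corollary2 :
    -- `c` is absolute; `C = C(γz)`, `cW = c(γw)` and `D = D(γε, γz, γw)`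
    ∃ (c : ℝ) (C : ℝ≥0 → ℝ) (cW : ℝ≥0 → ℝ) (D : ℝ≥0 → ℝ≥0 → ℝ≥0 → ℝ),
      0 < c ∧ (∀ γz, 0 < C γz) ∧ (∀ γw, 0 < cW γw) ∧ (∀ γε γz γw, 0 < D γε γz γw) ∧
      ∀ (γε γz γw : ℝ≥0), 0 < γε → 0 < γz → 0 < γw →
      ∀ (n p K : ℕ), 1 ≤ n → (K : ℝ) * Real.log n ≤ C γz * n →
      ∀ (θ : FactorPCR.Params p K)
        (Ω₀ : Type*) [MeasurableSpace Ω₀] (P₀ : Measure Ω₀) [IsProbabilityMeasure P₀]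
        (X₀ : Ω₀ → Fin p → ℝ) (Y₀ : Ω₀ → ℝ),
        FactorPCR.IsSubGaussianFRM P₀ θ γε γz γw X₀ Y₀ →
      ∀ (Ω : Type*) [MeasurableSpace Ω] (P : Measure Ω) [IsProbabilityMeasure P]
        (X : Ω → Matrix (Fin n) (Fin p) ℝ) (Y : Ω → Fin n → ℝ),
        FactorPCR.IsIIDSample P₀ P X₀ Y₀ X Y →
      -- a measurable choice of the right singular vectors of the data matrix
      ∀ (U : Matrix (Fin n) (Fin p) ℝ → Matrix (Fin p) (Fin p) ℝ),
        (∀ i j, Measurable fun M : Fin n → Fin p → ℝ => U (Matrix.of M) i j) →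
        (∀ M, FactorPCR.IsRightSingularBasis M (U M)) →
      -- a random number of components
      ∀ (k : Ω → ℕ), Measurable k → (∀ᵐ ω ∂P, k ω ≤ (X ω).rank) →
        ENNReal.ofReal (1 - c / n) ≤
          P {ω | FactorPCR.risk P₀ X₀ Y₀
                    (FactorPCR.coef (X ω) (Y ω) (FactorPCR.firstCols (U (X ω)) (k ω)))
                  - ENNReal.ofReal ((θ.sigma : ℝ) ^ 2) ≤
                ENNReal.ofReal (D γε γz γw) *
                  (FactorPCR.B1 θ (cW γw) (X ω) (k ω) + FactorPCR.B2 θ (cW γw) (X ω) (k ω))} := by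
  have hC : ∀ γz : ℝ≥0, ∃ C : ℝ, 0 < C ∧ (0 < γz → _) := fun γz => by
    by_cases hγ : 0 < γz
    · obtain ⟨C, hC0, hC⟩ := FactorPCR.exists_measure_factor_lower_le γz hγ
      exact ⟨C, hC0, fun _ => @hC⟩
    · exact ⟨1, one_pos, fun h => absurd h hγ⟩
  choose C hC0 hC using hC
  refine ⟨8, C, fun γw => 48 * (γw : ℝ) ^ 2 + 1,
    fun γε _ γw => 4000 * (1 + (γε : ℝ) ^ 2) * (1 + (γw : ℝ) ^ 2), by norm_num, hC0,
    fun _ => by positivity, fun _ _ _ => by positivity, ?_⟩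
  intro γε γz γw _ hγz _ n p K hn hK θ Ω₀ _ P₀ _ X₀ Y₀ hmodel Ω _ P _ X Y hs U hUm hU k _ hk
  obtain ⟨Z, W, ε, h, hε, ⟨Z', hZ', hZsub, hZ⟩, ⟨W', -, hWsub, hW⟩⟩ := hmodel
  -- For `n = 1` the claimed probability `1 - 8/n` is negative.
  rcases Nat.lt_or_ge n 2 with hn2 | hn2
  · have : n = 1 := by omega
    subst this
    rw [ENNReal.ofReal_of_nonpos (by norm_num)]
    exact zero_le
  have hlat := FactorPCR.measure_latent_failure_le h hn2 hε
    (FactorPCR.laplaceBound_of_eq_matSqrt h.moments_W.posSemidef hWsub.laplaceBound hW)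
    (hC γz hγz hn2 hK h hZ' hZsub hZ) hUm hU
  set F := FactorPCR.failureSet P₀ X₀ Y₀ θ U (48 * (γw : ℝ) ^ 2 + 1)
    (4000 * (1 + (γε : ℝ) ^ 2) * (1 + (γw : ℝ) ^ 2)) with hF
  have hFm : MeasurableSet F := FactorPCR.measurableSet_failureSet h hUm hU _ _
  have hdata : Measurable fun ω i => ((X ω i, Y ω i) : (Fin p → ℝ) × ℝ) :=
    measurable_pi_lambda _ fun i =>
      (measurable_pi_lambda _ fun j => hs.measurable_X i j).prodMk (hs.measurable_Y i)
  have hPF : P ((fun ω i => ((X ω i, Y ω i) : (Fin p → ℝ) × ℝ)) ⁻¹' F) ≤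
      ENNReal.ofReal (8 / n) := by
    rw [← Measure.map_apply hdata hFm, FactorPCR.map_sample_eq h hs,
      Measure.map_apply θ.measurable_dataOf hFm]
    exact hlat
  set G := {ω | FactorPCR.risk P₀ X₀ Y₀
      (FactorPCR.coef (X ω) (Y ω) (FactorPCR.firstCols (U (X ω)) (k ω)))
        - ENNReal.ofReal ((θ.sigma : ℝ) ^ 2) ≤
      ENNReal.ofReal (4000 * (1 + (γε : ℝ) ^ 2) * (1 + (γw : ℝ) ^ 2)) *
        (FactorPCR.B1 θ (48 * (γw : ℝ) ^ 2 + 1) (X ω) (k ω) +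
          FactorPCR.B2 θ (48 * (γw : ℝ) ^ 2 + 1) (X ω) (k ω))} with hG
  have hGc : P Gᶜ ≤ ENNReal.ofReal (8 / n) := by
    refine le_trans (measure_mono_ae ?_) hPF
    filter_upwards [hk] with ω hkω hω
    refine Set.mem_iUnion.2 ⟨k ω, hkω, ?_⟩
    have hω' : ω ∉ G := hω
    rw [hG, Set.mem_ofPred_eq, not_le] at hω'
    rw [(hU _).coef_eq] at hω'
    exact hω'
  -- Subadditivity suffices, so measurability of `G` is not needed.
  have huniv : 1 ≤ P G + P Gᶜ := by
    rw [← measure_univ (μ := P), ← Set.union_compl_self G]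
    exact measure_union_le _ _
  rw [ENNReal.ofReal_sub _ (by positivity), ENNReal.ofReal_one, tsub_le_iff_right]
  exact huniv.trans (by gcongr)
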